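/- There are $n\ge 2$ boxes and one searcher (Pandora). The prizes of the boxes are independent, each equal to $1$ with probability $\mu\in(0,1]$ and to $0$ otherwise; let $G_0$ be this Bernoulli distribution. A pure strategy of a box is a probability distribution $F$ on $[0,1]$ with mean $\mu$ (a distribution of posterior means); $M(\mu)$ denotes the set of these. A mixed strategy is a Borel probability measure on $M(\mu)$, with the topology of weak convergence. The boxes choose mixed strategies simultaneously. Pandora observes the realized vector $\mathbf F=(F_1,\dots,F_n)$ and then searches: inspecting a closed box $i$ costs $c$ immediately, takes one period, discounted by the factor $\beta$, and reveals a reward $x_i$ drawn independently from $F_i$; she may stop at any time, and then receives the maximum $w$ of the rewards sampled so far and of the outside option $0$. Her policy, which may depend on $\mathbf F$ and on the history, is optimal if it maximizes her expected discounted utility given $\mathbf F$. The reservation value $z_F$ is the solution of \[ z_F=-c+\beta\Big[\int_{-\infty}^{z_F} z_F\,dF+\int_{z_F}^{\infty}x\,dF(x)\Big]. \] The policy is fair if closed boxes whose reservation values are maximal among the closed boxes are visited next with equal probability, and if, upon stopping, each of the inspected boxes with reward $w$ is selected with equal probability. The payoff of a box is the probability that it is selected. An equilibrium (fair subgame perfect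 equilibrium in mixed strategies) consists of an optimal fair policy of Pandora for every $\mathbf F$ and a mixed strategy of each box such that no box can raise its expected payoff by changing its own mixed strategy; it is symmetric if all the boxes use the same mixed strategy. A mixed strategy has an induced mass point $a$ on a reservation value $z$ if it plays the distributions $F$ with $z_F=z$ with total probability $a$. **Proposition 8.** Suppose that $c\ge 0$, $0<\beta\le 1$, $\beta\mu>c$, and that there are frictions, i.e. $c>0$ or $\beta<1$. Then there is no symmetric mixed strategy equilibrium in which there is an induced mass point $a>0$ on any reservation value $z\ne z_{G_0}$. -/

import Mathlib

open MeasureTheory Set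

/-- Pure strategies of a box: the set `M(μ)` of probability distributions supported on `[0, 1]`
with mean `μ`. It carries the σ-algebra generated by the evaluations `F ↦ F A`, which is the Borel
σ-algebra of the topology of weak convergence. -/
abbrev PureStrategy (μ : ℝ) : Type :=
  {F : ProbabilityMeasure ℝ //
    (F : Measure ℝ) (Icc (0 : ℝ) 1)ᶜ = 0 ∧ ∫ x, x ∂(F : Measure ℝ) = μ}

/-- The measure on `ℝ` underlying a pure strategy. -/
def PureStrategy.law {μ : ℝ} (F : PureStrategy μ) : Measure ℝ := (F.1 : Measure ℝ)

/-- Mixed strategies: Borel probability distributions over pure strategies. -/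
abbrev MixedStrategy (μ : ℝ) : Type := ProbabilityMeasure (PureStrategy μ)

/-- The prior `G₀`, induced by a fully informative signal: the Bernoulli distribution with
mean `μ`. -/
noncomputable def priorLaw (μ : ℝ) : Measure ℝ :=
  ENNReal.ofReal (1 - μ) • Measure.dirac 0 + ENNReal.ofReal μ • Measure.dirac 1

/-- `z` solves the equation of the reservation price for inspection cost `c`, discount
factor `β` and distribution `F`. -/
def IsReservationPrice (c β : ℝ) (F : Measure ℝ) (z : ℝ) : Prop :=
  z = -c + β * ((∫ _ in Iic z, z ∂F) + ∫ x in Ioi z, x ∂F)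

/-- With frictions, the equation of the reservation price has exactly one solution. -/
theorem existsUnique_isReservationPrice {c β : ℝ} {F : Measure ℝ} [IsProbabilityMeasure F]
    (hF : F (Icc (0 : ℝ) 1)ᶜ = 0) (hc : 0 ≤ c) (hβ : 0 < β) (hβ1 : β ≤ 1)
    (hfric : 0 < c ∨ β < 1) : ∃! z, IsReservationPrice c β F z := by
  have hae : ∀ᵐ x ∂F, x ∈ Icc (0 : ℝ) 1 := by
    rw [ae_iff]; exact hF
  have hint : ∀ z : ℝ, Integrable (fun x : ℝ => max x z) F := by
    intro z
    refine Integrable.of_bound (C := 1 + |z|) (by fun_prop) ?_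
    filter_upwards [hae] with x hx
    rw [Real.norm_eq_abs, abs_le]
    have h1 := neg_abs_le z
    have h2 := le_abs_self z
    have h3 := hx.1
    have h4 := hx.2
    constructor
    · linarith [le_max_left x z]
    · exact max_le (by linarith) (by linarith)
  have hsplit : ∀ z : ℝ, (∫ _ in Iic z, z ∂F) + ∫ x in Ioi z, x ∂F = ∫ x, max x z ∂F := by
    intro z
    rw [← integral_add_compl (measurableSet_Iic (a := z)) (hint z), compl_Iic]
    congr 1
    · exact setIntegral_congr_fun measurableSet_Iic fun x hx => (max_eq_right hx).symm
    · exact setIntegral_congr_fun measurableSet_Ioi fun x hx => (max_eq_left (le_of_lt hx)).symm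
  have hiff : ∀ z, IsReservationPrice c β F z ↔ z = -c + β * ∫ x, max x z ∂F := by
    intro z
    rw [IsReservationPrice, hsplit]
  have hlip : ∀ z₁ z₂ : ℝ, z₁ ≤ z₂ →
      ∫ x, max x z₂ ∂F ≤ (∫ x, max x z₁ ∂F) + (z₂ - z₁) := by
    intro z₁ z₂ h
    have h1 : ∫ x, max x z₂ ∂F ≤ ∫ x, (max x z₁ + (z₂ - z₁)) ∂F := by
      refine integral_mono (hint z₂) ((hint z₁).add (integrable_const _)) fun x => ?_
      show max x z₂ ≤ max x z₁ + (z₂ - z₁)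
      exact max_le (by linarith [le_max_left x z₁]) (by linarith [le_max_right x z₁])
    rwa [integral_add (hint z₁) (integrable_const _), integral_const, probReal_univ,
      one_smul] at h1
  have hmono : ∀ z₁ z₂ : ℝ, z₁ ≤ z₂ → ∫ x, max x z₁ ∂F ≤ ∫ x, max x z₂ ∂F := fun z₁ z₂ h =>
    integral_mono (hint z₁) (hint z₂) fun x => max_le_max_left x h
  have hcont : Continuous fun z : ℝ => ∫ x, max x z ∂F := by
    refine (LipschitzWith.of_le_add fun z w => ?_).continuous
    rw [Real.dist_eq]
    rcases le_total z w with h | h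
    · have := hmono z w h
      linarith [abs_nonneg (z - w)]
    · have := hlip w z h
      rw [abs_of_nonneg (by linarith)]
      exact this
  have hone : ∀ z : ℝ, 1 ≤ z → ∫ x, max x z ∂F = z := by
    intro z hz
    have : ∫ x, max x z ∂F = ∫ _, z ∂F := by
      refine integral_congr_ae ?_
      filter_upwards [hae] with x hx
      exact max_eq_right (hx.2.trans hz)
    rw [this, integral_const, probReal_univ, one_smul]
  have hge : ∀ z : ℝ, z ≤ ∫ x, max x z ∂F := by
    intro z
    have : ∫ _, z ∂F ≤ ∫ x, max x z ∂F :=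
      integral_mono (integrable_const _) (hint z) fun x => le_max_right x z
    rwa [integral_const, probReal_univ, one_smul] at this
  have hnn : 0 ≤ ∫ x, max x (-c) ∂F := by
    refine integral_nonneg_of_ae ?_
    filter_upwards [hae] with x hx
    exact le_max_of_le_left hx.1
  -- existence
  have hex : ∃ z ∈ Icc (-c) 1, z - (-c + β * ∫ x, max x z ∂F) = 0 := by
    have hcg : ContinuousOn (fun z : ℝ => z - (-c + β * ∫ x, max x z ∂F)) (Icc (-c) 1) :=
      (continuous_id.sub (continuous_const.add (continuous_const.mul hcont))).continuousOn
    have := intermediate_value_Icc (by linarith) hcg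
    refine this ⟨?_, ?_⟩
    · show -c - (-c + β * ∫ x, max x (-c) ∂F) ≤ 0
      nlinarith [mul_nonneg hβ.le hnn]
    · show 0 ≤ 1 - (-c + β * ∫ x, max x 1 ∂F)
      rw [hone 1 le_rfl]
      linarith
  obtain ⟨z, -, hz⟩ := hex
  -- uniqueness
  have huniq : ∀ z₁ z₂ : ℝ, z₁ = -c + β * ∫ x, max x z₁ ∂F → z₂ = -c + β * ∫ x, max x z₂ ∂F →
      ¬ z₁ < z₂ := by
    intro z₁ z₂ h1 h2 hlt
    have hl := hlip z₁ z₂ hlt.le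
    have hβ' : β = 1 := by
      by_contra hne
      have hlt1 : β < 1 := lt_of_le_of_ne hβ1 hne
      have h3 := mul_le_mul_of_nonneg_left hl hβ.le
      nlinarith
    have hc' : 0 < c := hfric.resolve_right (by rw [hβ']; exact lt_irrefl 1)
    rw [hβ', one_mul] at h1 h2
    have heq : ∫ x, ((max x z₁ + (z₂ - z₁)) - max x z₂) ∂F = 0 := by
      have hi : Integrable (fun x : ℝ => max x z₁ + (z₂ - z₁)) F :=
        (hint z₁).add (integrable_const _)
      rw [integral_sub hi (hint z₂), integral_add (hint z₁) (integrable_const _),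
        integral_const, probReal_univ, one_smul]
      linarith
    have hz : (fun x : ℝ => (max x z₁ + (z₂ - z₁)) - max x z₂) =ᵐ[F] 0 := by
      refine (integral_eq_zero_iff_of_nonneg (fun x => ?_)
        (((hint z₁).add (integrable_const _)).sub (hint z₂))).1 heq
      show 0 ≤ (max x z₁ + (z₂ - z₁)) - max x z₂
      have : max x z₂ ≤ max x z₁ + (z₂ - z₁) :=
        max_le (by linarith [le_max_left x z₁]) (by linarith [le_max_right x z₁])
      linarith
    have hmax : ∫ x, max x z₁ ∂F = ∫ _, z₁ ∂F := by
      refine integral_congr_ae ?_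
      filter_upwards [hz] with x hx
      have hx' : (max x z₁ + (z₂ - z₁)) - max x z₂ = 0 := hx
      refine max_eq_right ?_
      by_contra hgt
      rw [max_eq_left (not_le.1 hgt).le] at hx'
      rcases le_total x z₂ with h | h
      · rw [max_eq_right h] at hx'
        linarith [not_le.1 hgt]
      · rw [max_eq_left h] at hx'
        linarith
    rw [integral_const, probReal_univ, one_smul] at hmax
    linarith
  refine ⟨z, (hiff z).2 (by linarith), fun y hy => ?_⟩
  have hy' := (hiff y).1 hy
  have hz' : z = -c + β * ∫ x, max x z ∂F := by linarith
  rcases lt_trichotomy y z with h | h | h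
  · exact absurd h (huniq y z hy' hz')
  · exact h
  · exact absurd h (huniq z y hz' hy')

/-- The reservation price `z_F`: the solution of the equation above. -/
noncomputable def reservationPrice (c β : ℝ) (F : Measure ℝ) : ℝ :=
  Classical.epsilon (IsReservationPrice c β F)

/-- A (possibly randomized) policy for Pandora. A history is the list `h` of the boxes inspected so
far (most recent first) with the vector `x` of their realized rewards, where `x i = 0` for the
boxes `i` that are still closed. `visit h x i` is the probability that the next action is to inspect
the closed box `i`; with the remaining probability Pandora stops. -/
structure Policy (n : ℕ) where
  visit : List (Fin n) → (Fin n → ℝ) → Fin n → ℝ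
  visit_nonneg : ∀ h x i, 0 ≤ visit h x i
  visit_opened : ∀ h x i, i ∈ h → visit h x i = 0
  sum_visit_le : ∀ h x, ∑ i, visit h x i ≤ 1
  measurable_visit : ∀ h i, Measurable fun x => visit h x i

/-- The probability of stopping at a history. -/
def Policy.stopProb {n : ℕ} (η : Policy n) (h : List (Fin n)) (x : Fin n → ℝ) : ℝ :=
  1 - ∑ i, η.visit h x i

/-- The maximum sampled reward `w`, the outside option `0` included. -/
def maxSampled {n : ℕ} (h : List (Fin n)) (x : Fin n → ℝ) : ℝ :=
  (h.map x).foldr max 0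

open Classical in
/-- The set `O*` of inspected boxes whose reward is the maximum sampled reward. -/
noncomputable def bestOpened {n : ℕ} (h : List (Fin n)) (x : Fin n → ℝ) : Finset (Fin n) :=
  {i | i ∈ h ∧ x i = maxSampled h x}

/-- The set `U*` of closed boxes with the maximal value of `z` among the closed boxes. -/
def bestClosed {n : ℕ} (z : Fin n → ℝ) (h : List (Fin n)) : Set (Fin n) :=
  {i | i ∉ h ∧ ∀ j, j ∉ h → z j ≤ z i}

/-- Pandora's expected utility from following `η` from a history on, when at most `k` further boxes
can be inspected: an inspection costs `c` now and delays everything that follows it by one period,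
discounted by `β`; upon stopping she gets the maximum sampled reward. -/
noncomputable def pandoraValueAux {n : ℕ} (c β : ℝ) (F : Fin n → Measure ℝ) (η : Policy n) :
    ℕ → List (Fin n) → (Fin n → ℝ) → ℝ
  | 0, h, x => maxSampled h x
  | k + 1, h, x => η.stopProb h x * maxSampled h x +
      ∑ j, η.visit h x j *
        (-c + β * ∫ v, pandoraValueAux c β F η k (j :: h) (Function.update x j v) ∂(F j))

/-- Pandora's expected utility `u_P` of the policy `η` when the boxes have chosen `F`. -/
noncomputable def pandoraValue {n : ℕ} (c β : ℝ) (F : Fin n → Measure ℝ) (η : Policy n) : ℝ :=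
  pandoraValueAux c β F η n [] 0

open Classical in
/-- The probability that box `i` is selected when Pandora stops: she selects each member of `O*`
with equal probability. -/
noncomputable def claimProb {n : ℕ} (i : Fin n) (h : List (Fin n)) (x : Fin n → ℝ) : ℝ :=
  if i ∈ bestOpened h x then 1 / ((bestOpened h x).card : ℝ) else 0

/-- The probability that box `i` is eventually selected under `η` from a history on, when at most
`k` further boxes can be inspected. -/
noncomputable def winProbAux {n : ℕ} (F : Fin n → Measure ℝ) (η : Policy n) (i : Fin n) :
    ℕ → List (Fin n) → (Fin n → ℝ) → ℝ
  | 0, h, x => claimProb i h x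
  | k + 1, h, x => η.stopProb h x * claimProb i h x +
      ∑ j, η.visit h x j * ∫ v, winProbAux F η i k (j :: h) (Function.update x j v) ∂(F j)

/-- The probability that box `i` is selected when the boxes have chosen `F` and Pandora
follows `η`. -/
noncomputable def winProb {n : ℕ} (F : Fin n → Measure ℝ) (η : Policy n) (i : Fin n) : ℝ :=
  winProbAux F η i n [] 0

/-- `η` is optimal for Pandora when the boxes have chosen `F`. -/
def Policy.IsOptimal {n : ℕ} (c β : ℝ) (F : Fin n → Measure ℝ) (η : Policy n) : Prop :=
  ∀ η' : Policy n, pandoraValue c β F η' ≤ pandoraValue c β F η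

/-- `η` is fair: the members of `U*` are visited next with equal probability. (The equal treatment
of the members of `O*` is part of `claimProb`.) -/
def Policy.IsFair {n : ℕ} (c β : ℝ) (F : Fin n → Measure ℝ) (η : Policy n) : Prop :=
  ∀ h x i j, i ∈ bestClosed (fun k => reservationPrice c β (F k)) h →
    j ∈ bestClosed (fun k => reservationPrice c β (F k)) h → η.visit h x i = η.visit h x j

/-- A strategy of Pandora: a policy for each vector of distributions chosen by the boxes, which
she observes before she searches. -/
structure PandoraStrategy (n : ℕ) (μ : ℝ) where
  policy : (Fin n → PureStrategy μ) → Policy n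
  measurable_policy : ∀ h i, Measurable fun p : (Fin n → PureStrategy μ) × (Fin n → ℝ) =>
    (policy p.1).visit h p.2 i

/-- The expected payoff of box `i`, i.e. the probability that it is selected, when the boxes use
the mixed strategies `σ` (independently) and Pandora uses `η`. -/
noncomputable def boxPayoff {n : ℕ} {μ : ℝ} (η : PandoraStrategy n μ)
    (σ : Fin n → MixedStrategy μ) (i : Fin n) : ℝ :=
  ∫ F, winProb (fun j => (F j).law) (η.policy F) i
    ∂(Measure.pi fun j => (σ j : Measure (PureStrategy μ)))

/-- Fair subgame perfect equilibrium in mixed strategies. -/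
structure IsFSPE {n : ℕ} {μ : ℝ} (c β : ℝ) (η : PandoraStrategy n μ)
    (σ : Fin n → MixedStrategy μ) : Prop where
  optimal : ∀ F : Fin n → PureStrategy μ, (η.policy F).IsOptimal c β fun j => (F j).law
  fair : ∀ F : Fin n → PureStrategy μ, (η.policy F).IsFair c β fun j => (F j).law
  no_deviation : ∀ (i : Fin n) (τ : MixedStrategy μ),
    boxPayoff η (Function.update σ i τ) i ≤ boxPayoff η σ i

/-- The mixed strategy `s` has an induced mass point of size `a` on the reservation value `z`: the
distributions that induce `z` are played with total probability `a`. -/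
def HasInducedMass {μ : ℝ} (c β : ℝ) (s : MixedStrategy μ) (z : ℝ) (a : ENNReal) : Prop :=
  (s : Measure (PureStrategy μ)) {F | reservationPrice c β F.law = z} = a

/-! By Weitzman's index rule, the box that an optimal Pandora selects maximizes the truncated reward
min(x_i, z_i). So the selection probability of box i lies between the probability that its truncated
reward is the unique maximum and the probability that it is a maximum (`winProb_mem_of_isOptimal`).
The two bounds differ only by ties.

A box playing H with z_H < z_{G₀} can win its ties at arbitrarily small cost. With probability θ
close to 1 it pushes its reward slightly upwards. The remaining mass goes to a two-point law that is
spread out enough to raise the reservation price, and whose mean is below μ, which pays for the push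
(`exists_perturbation`). This turns weak wins into strict wins with probability at least θ. Letting
θ tend to 1, almost every such H in the support of an equilibrium strategy must already win all its
ties (`integral_weakWinProb_le_boxPayoff`, `ae_weakWinProb_eq`).

No law has a larger reservation price than G₀, so a mass point a > 0 at z ≠ z_{G₀} lies below
z_{G₀}. With probability a^n all boxes have reservation price z, and then with positive probability
all rewards exceed z, which is an n-fold tie that every box would have to win. The weak win
probabilities add up to more than one (`one_lt_sum_weakWinProb`), the selection probabilities to at
most one (`sum_winProbAux_le_one`): a contradiction.

The index rule comes from an explicit value function, whose derivative in the outside option m is a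
product over the closed boxes, with factor βF_j(m) below z_j and 1 from z_j on. The losses from
stopping and from inspecting a given box are then integrals of nonnegative functions, which vanish
exactly for the actions that the rule allows. -/

/-! ### Reservation prices -/

section ReservationPrice

variable {c β : ℝ} {F : Measure ℝ}

theorem ae_mem_Icc_of_compl_null (hF : F (Icc (0 : ℝ) 1)ᶜ = 0) : ∀ᵐ x ∂F, x ∈ Icc (0 : ℝ) 1 := by
  rw [ae_iff]; exact hF

theorem integrable_max_const [IsFiniteMeasure F] (hF : F (Icc (0 : ℝ) 1)ᶜ = 0) (z : ℝ) :
    Integrable (fun x : ℝ => max x z) F := by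
  refine Integrable.of_bound (C := 1 + |z|) (by fun_prop) ?_
  filter_upwards [ae_mem_Icc_of_compl_null hF] with x hx
  rw [Real.norm_eq_abs, abs_le]
  have h1 := neg_abs_le z
  have h2 := le_abs_self z
  have h3 := hx.1
  have h4 := hx.2
  constructor
  · linarith [le_max_left x z]
  · exact max_le (by linarith) (by linarith)

theorem isReservationPrice_iff [IsFiniteMeasure F] (hF : F (Icc (0 : ℝ) 1)ᶜ = 0) (z : ℝ) :
    IsReservationPrice c β F z ↔ z = -c + β * ∫ x, max x z ∂F := by
  have : (∫ _ in Iic z, z ∂F) + ∫ x in Ioi z, x ∂F = ∫ x, max x z ∂F := by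
    rw [← integral_add_compl (measurableSet_Iic (a := z)) (integrable_max_const hF z), compl_Iic]
    congr 1
    · exact setIntegral_congr_fun measurableSet_Iic fun x hx => (max_eq_right hx).symm
    · exact setIntegral_congr_fun measurableSet_Ioi fun x hx => (max_eq_left (le_of_lt hx)).symm
  rw [IsReservationPrice, this]

theorem integral_max_le_add [IsProbabilityMeasure F] (hF : F (Icc (0 : ℝ) 1)ᶜ = 0) {s t : ℝ}
    (h : s ≤ t) : ∫ x, max x t ∂F ≤ (∫ x, max x s ∂F) + (t - s) := by
  have h1 : ∫ x, max x t ∂F ≤ ∫ x, (max x s + (t - s)) ∂F := by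
    refine integral_mono (integrable_max_const hF t)
      ((integrable_max_const hF s).add (integrable_const _)) fun x => ?_
    show max x t ≤ max x s + (t - s)
    exact max_le (by linarith [le_max_left x s]) (by linarith [le_max_right x s])
  rwa [integral_add (integrable_max_const hF s) (integrable_const _), integral_const,
    probReal_univ, one_smul] at h1

theorem le_integral_max [IsProbabilityMeasure F] (hF : F (Icc (0 : ℝ) 1)ᶜ = 0) (t : ℝ) :
    t ≤ ∫ x, max x t ∂F := by
  have : ∫ _, t ∂F ≤ ∫ x, max x t ∂F :=
    integral_mono (integrable_const _) (integrable_max_const hF t) fun x => le_max_right x t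
  rwa [integral_const, probReal_univ, one_smul] at this

variable [IsProbabilityMeasure F]

theorem reservationPrice_eq (hF : F (Icc (0 : ℝ) 1)ᶜ = 0) (hc : 0 ≤ c) (hβ : 0 < β) (hβ1 : β ≤ 1)
    (hfric : 0 < c ∨ β < 1) :
    reservationPrice c β F = -c + β * ∫ x, max x (reservationPrice c β F) ∂F :=
  (isReservationPrice_iff hF _).1
    (Classical.epsilon_spec (existsUnique_isReservationPrice hF hc hβ hβ1 hfric).exists)

/-- The function t ↦ t - (-c + β ∫ max(x, t) dF) is nondecreasing and vanishes only at z_F, so its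
sign locates t. Comparing the prices of two laws thus reduces to comparing ∫ max(x, t) at a single
t. -/
theorem lt_reservationPrice_iff (hF : F (Icc (0 : ℝ) 1)ᶜ = 0) (hc : 0 ≤ c) (hβ : 0 < β)
    (hβ1 : β ≤ 1) (hfric : 0 < c ∨ β < 1) (t : ℝ) :
    t < reservationPrice c β F ↔ t < -c + β * ∫ x, max x t ∂F := by
  have key : ∀ s t : ℝ, s ≤ t →
      s - (-c + β * ∫ x, max x s ∂F) ≤ t - (-c + β * ∫ x, max x t ∂F) := by
    intro s t h
    nlinarith [mul_le_mul_of_nonneg_left (integral_max_le_add hF h) hβ.le]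
  have heq := reservationPrice_eq hF hc hβ hβ1 hfric
  constructor
  · intro h
    have h1 := key _ _ h.le
    refine lt_of_le_of_ne (by linarith) fun h2 => h.ne ?_
    exact (existsUnique_isReservationPrice hF hc hβ hβ1 hfric).unique
      ((isReservationPrice_iff hF _).2 h2) ((isReservationPrice_iff hF _).2 heq)
  · intro h
    by_contra hle
    have h1 := key _ _ (not_lt.1 hle)
    linarith

theorem reservationPrice_lt_of_integral_max_lt {G : Measure ℝ} [IsProbabilityMeasure G]
    (hF : F (Icc (0 : ℝ) 1)ᶜ = 0) (hG : G (Icc (0 : ℝ) 1)ᶜ = 0)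
    (hc : 0 ≤ c) (hβ : 0 < β) (hβ1 : β ≤ 1) (hfric : 0 < c ∨ β < 1)
    (h : ∫ x, max x (reservationPrice c β F) ∂F < ∫ x, max x (reservationPrice c β F) ∂G) :
    reservationPrice c β F < reservationPrice c β G := by
  rw [lt_reservationPrice_iff hG hc hβ hβ1 hfric]
  have := mul_lt_mul_of_pos_left h hβ
  linarith [reservationPrice_eq hF hc hβ hβ1 hfric]

theorem integral_max_lt_of_reservationPrice_lt {G : Measure ℝ} [IsProbabilityMeasure G]
    (hF : F (Icc (0 : ℝ) 1)ᶜ = 0) (hG : G (Icc (0 : ℝ) 1)ᶜ = 0)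
    (hc : 0 ≤ c) (hβ : 0 < β) (hβ1 : β ≤ 1) (hfric : 0 < c ∨ β < 1)
    (h : reservationPrice c β F < reservationPrice c β G) :
    ∫ x, max x (reservationPrice c β F) ∂F < ∫ x, max x (reservationPrice c β F) ∂G := by
  rw [lt_reservationPrice_iff hG hc hβ hβ1 hfric] at h
  have h2 := reservationPrice_eq hF hc hβ hβ1 hfric
  exact lt_of_mul_lt_mul_left (by linarith) hβ.le

theorem reservationPrice_pos (hF : F (Icc (0 : ℝ) 1)ᶜ = 0) (hc : 0 ≤ c) (hβ : 0 < β)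
    (hβ1 : β ≤ 1) (hfric : 0 < c ∨ β < 1) (hs : c < β * ∫ x, x ∂F) :
    0 < reservationPrice c β F := by
  rw [lt_reservationPrice_iff hF hc hβ hβ1 hfric]
  have : ∫ x, max x 0 ∂F = ∫ x, x ∂F := by
    refine integral_congr_ae ?_
    filter_upwards [ae_mem_Icc_of_compl_null hF] with x hx
    exact max_eq_left hx.1
  rw [this]
  linarith

/-- Equality would give c + (1 - β) z = 0, which frictions exclude because z > 0. -/
theorem reservationPrice_lt_integral_max (hF : F (Icc (0 : ℝ) 1)ᶜ = 0) (hc : 0 ≤ c) (hβ : 0 < β)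
    (hβ1 : β ≤ 1) (hfric : 0 < c ∨ β < 1) (hs : c < β * ∫ x, x ∂F) :
    reservationPrice c β F < ∫ x, max x (reservationPrice c β F) ∂F := by
  have h0 := reservationPrice_pos hF hc hβ hβ1 hfric hs
  have h1 := reservationPrice_eq hF hc hβ hβ1 hfric
  refine lt_of_le_of_ne (le_integral_max hF _) fun h => ?_
  rw [← h] at h1
  rcases hfric with h2 | h2 <;> nlinarith

theorem reservationPrice_lt_one (hF : F (Icc (0 : ℝ) 1)ᶜ = 0) (hc : 0 ≤ c) (hβ : 0 < β)
    (hβ1 : β ≤ 1) (hfric : 0 < c ∨ β < 1) (hs : c < β * ∫ x, x ∂F) :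
    reservationPrice c β F < 1 := by
  have h1 := reservationPrice_lt_integral_max hF hc hβ hβ1 hfric hs
  by_contra h
  refine h1.ne ?_
  have : ∫ x, max x (reservationPrice c β F) ∂F = ∫ _, reservationPrice c β F ∂F := by
    refine integral_congr_ae ?_
    filter_upwards [ae_mem_Icc_of_compl_null hF] with x hx
    exact max_eq_right (hx.2.trans (not_lt.1 h))
  rw [this, integral_const, probReal_univ, one_smul]

theorem measure_Ioi_reservationPrice_pos (hF : F (Icc (0 : ℝ) 1)ᶜ = 0) (hc : 0 ≤ c) (hβ : 0 < β)
    (hβ1 : β ≤ 1) (hfric : 0 < c ∨ β < 1) (hs : c < β * ∫ x, x ∂F) :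
    0 < F (Ioi (reservationPrice c β F)) := by
  have h1 := reservationPrice_lt_integral_max hF hc hβ hβ1 hfric hs
  rw [pos_iff_ne_zero]
  intro h
  refine h1.ne ?_
  have h2 : ∀ᵐ x ∂F, x ∉ Ioi (reservationPrice c β F) := measure_eq_zero_iff_ae_notMem.1 h
  have : ∫ x, max x (reservationPrice c β F) ∂F = ∫ _, reservationPrice c β F ∂F := by
    refine integral_congr_ae ?_
    filter_upwards [h2] with x hx
    exact max_eq_right (not_lt.1 hx)
  rw [this, integral_const, probReal_univ, one_smul]

end ReservationPrice

/-! ### Pure strategies -/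

namespace PureStrategy

variable {μ : ℝ}

instance (F : PureStrategy μ) : IsProbabilityMeasure F.law := F.1.2

theorem law_compl_Icc (F : PureStrategy μ) : F.law (Icc (0 : ℝ) 1)ᶜ = 0 := F.2.1

theorem integral_law (F : PureStrategy μ) : ∫ x, x ∂F.law = μ := F.2.2

theorem measurable_law : Measurable (PureStrategy.law : PureStrategy μ → Measure ℝ) :=
  measurable_subtype_coe.comp measurable_subtype_coe

/-- The pure strategy with a given law. -/
def ofMeasure (F : Measure ℝ) [IsProbabilityMeasure F] (h : F (Icc (0 : ℝ) 1)ᶜ = 0)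
    (hμ : ∫ x, x ∂F = μ) : PureStrategy μ := ⟨⟨F, inferInstance⟩, h, hμ⟩

@[simp] theorem law_ofMeasure (F : Measure ℝ) [IsProbabilityMeasure F] (h : F (Icc (0 : ℝ) 1)ᶜ = 0)
    (hμ : ∫ x, x ∂F = μ) : (ofMeasure F h hμ).law = F := rfl

/-- The law of a pure strategy, as a kernel. -/
noncomputable def lawKernel (μ : ℝ) : ProbabilityTheory.Kernel (PureStrategy μ) ℝ where
  toFun := PureStrategy.law
  measurable' := measurable_law

instance : ProbabilityTheory.IsMarkovKernel (lawKernel μ) :=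
  ⟨fun F => inferInstanceAs (IsProbabilityMeasure F.law)⟩

/-- By `lt_reservationPrice_iff` the superlevel sets are described by the integrals ∫ max(x, t) dF,
which depend measurably on F. -/
theorem measurable_reservationPrice {c β : ℝ} (hc : 0 ≤ c) (hβ : 0 < β)
    (hβ1 : β ≤ 1) (hfric : 0 < c ∨ β < 1) :
    Measurable fun F : PureStrategy μ => reservationPrice c β F.law := by
  refine measurable_of_Ioi fun t => ?_
  have : (fun F : PureStrategy μ => reservationPrice c β F.law) ⁻¹' Ioi t =
      {F | t < -c + β * ∫ x, max x t ∂(lawKernel μ F)} := by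
    ext F
    exact lt_reservationPrice_iff F.law_compl_Icc hc hβ hβ1 hfric t
  rw [this]
  have hm : Measurable fun F : PureStrategy μ => ∫ x, max x t ∂(lawKernel μ F) := by
    refine (StronglyMeasurable.integral_kernel (f := fun x : ℝ => max x t) ?_).measurable
    exact (by fun_prop : Measurable fun x : ℝ => max x t).stronglyMeasurable
  exact measurableSet_lt measurable_const (measurable_const.add (measurable_const.mul hm))

end PureStrategy

/-! ### The prior and two-point laws -/

theorem isProbabilityMeasure_priorLaw {q : ℝ} (h0 : 0 ≤ q) (h1 : q ≤ 1) :
    IsProbabilityMeasure (priorLaw q) := by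
  constructor
  simp only [priorLaw, Measure.coe_add, Measure.coe_smul, Pi.add_apply, Pi.smul_apply,
    measure_univ, smul_eq_mul, mul_one]
  rw [← ENNReal.ofReal_add (by linarith) h0]
  simp

theorem priorLaw_compl_Icc (q : ℝ) : priorLaw q (Icc (0 : ℝ) 1)ᶜ = 0 := by
  simp [priorLaw]

theorem integral_priorLaw {q : ℝ} (h0 : 0 ≤ q) (h1 : q ≤ 1) {f : ℝ → ℝ} (hf : Measurable f) :
    ∫ x, f x ∂(priorLaw q) = (1 - q) * f 0 + q * f 1 := by
  have hi : ∀ a : ℝ, Integrable f (Measure.dirac a) := fun a =>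
    integrable_dirac' hf.stronglyMeasurable (by simp)
  rw [priorLaw, integral_add_measure ((hi 0).smul_measure (by simp)) ((hi 1).smul_measure (by simp)),
    integral_smul_measure, integral_smul_measure,
    integral_dirac' _ _ hf.stronglyMeasurable, integral_dirac' _ _ hf.stronglyMeasurable,
    ENNReal.toReal_ofReal (by linarith), ENNReal.toReal_ofReal h0]
  simp

/-- The convex function x ↦ max(x, z) lies below its chord z + (1 - z)x on [0, 1]; the Bernoulli law
attains the bound. -/
theorem integral_max_le_priorLaw {F : Measure ℝ} [IsProbabilityMeasure F]
    (hF : F (Icc (0 : ℝ) 1)ᶜ = 0) {z : ℝ} (h0 : 0 ≤ z) (h1 : z ≤ 1) :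
    ∫ x, max x z ∂F ≤ (1 - ∫ x, x ∂F) * z + ∫ x, x ∂F := by
  have hi : Integrable (fun x : ℝ => x) F := by
    refine (integrable_max_const hF 0).congr ?_
    filter_upwards [ae_mem_Icc_of_compl_null hF] with x hx
    exact max_eq_left hx.1
  have : ∫ x, max x z ∂F ≤ ∫ x, (z + (1 - z) * x) ∂F := by
    refine integral_mono_ae (integrable_max_const hF z)
      ((integrable_const _).add (hi.const_mul _)) ?_
    filter_upwards [ae_mem_Icc_of_compl_null hF] with x hx
    obtain ⟨hx0, hx1⟩ := hx
    exact max_le (by nlinarith) (by nlinarith)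
  rw [integral_add (integrable_const _) (hi.const_mul _), integral_const, integral_const_mul,
    probReal_univ, one_smul] at this
  linarith

/-- The prior maximizes ∫ max(x, t) among the laws on [0, 1] with mean μ; this is used at t =
z_{G₀}. -/
theorem reservationPrice_le_priorLaw {μ c β : ℝ} (hμ0 : 0 < μ) (hμ1 : μ ≤ 1)
    (hc : 0 ≤ c) (hβ0 : 0 < β) (hβ1 : β ≤ 1) (hsearch : c < β * μ) (hfric : 0 < c ∨ β < 1)
    (H : PureStrategy μ) : reservationPrice c β H.law ≤ reservationPrice c β (priorLaw μ) := by
  have := isProbabilityMeasure_priorLaw hμ0.le hμ1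
  have hs : c < β * ∫ x, x ∂(priorLaw μ) := by
    rw [integral_priorLaw (f := fun x => x) hμ0.le hμ1 measurable_id]
    simpa using hsearch
  have h0 := reservationPrice_pos (priorLaw_compl_Icc μ) hc hβ0 hβ1 hfric hs
  have h1 := reservationPrice_lt_one (priorLaw_compl_Icc μ) hc hβ0 hβ1 hfric hs
  by_contra h
  have h2 := integral_max_lt_of_reservationPrice_lt (priorLaw_compl_Icc μ) H.law_compl_Icc
    hc hβ0 hβ1 hfric (not_le.1 h)
  have h3 := integral_max_le_priorLaw H.law_compl_Icc h0.le h1.le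
  rw [integral_priorLaw hμ0.le hμ1 (by fun_prop), max_eq_right h0.le, max_eq_left h1.le,
    mul_one] at h2
  rw [H.integral_law] at h3
  linarith

/-- A pure strategy whose reservation price is below that of the prior can be perturbed so that
the reservation price and, with probability arbitrarily close to one, the reward both increase. -/
theorem exists_perturbation {μ c β : ℝ} (hμ0 : 0 < μ) (hμ1 : μ ≤ 1)
    (hc : 0 ≤ c) (hβ0 : 0 < β) (hβ1 : β ≤ 1) (hsearch : c < β * μ) (hfric : 0 < c ∨ β < 1)
    (H : PureStrategy μ) (hH : reservationPrice c β H.law < reservationPrice c β (priorLaw μ)) :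
    ∃ θ₀ < (1 : ℝ), ∀ θ : ℝ, θ₀ < θ → θ < 1 → ∃ (G : PureStrategy μ) (T : ℝ → ℝ), Measurable T ∧
      ENNReal.ofReal θ • (H.law.map T) ≤ G.law ∧
      reservationPrice c β H.law < reservationPrice c β G.law ∧
      ∀ x ∈ Icc (0 : ℝ) 1, min x (reservationPrice c β H.law) <
        min (T x) (reservationPrice c β G.law) := by
  have := isProbabilityMeasure_priorLaw hμ0.le hμ1
  set z := reservationPrice c β H.law with hz
  have hmean := H.integral_law
  have hs : c < β * ∫ x, x ∂H.law := by rw [hmean]; exact hsearch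
  have hz0 : 0 < z := reservationPrice_pos H.law_compl_Icc hc hβ0 hβ1 hfric hs
  have hz1 : z < 1 := reservationPrice_lt_one H.law_compl_Icc hc hβ0 hβ1 hfric hs
  have hzm : z < ∫ x, max x z ∂H.law :=
    reservationPrice_lt_integral_max H.law_compl_Icc hc hβ0 hβ1 hfric hs
  have hM := integral_max_lt_of_reservationPrice_lt H.law_compl_Icc (priorLaw_compl_Icc μ)
    hc hβ0 hβ1 hfric hH
  rw [← hz, integral_priorLaw hμ0.le hμ1 (by fun_prop), max_eq_right hz0.le, max_eq_left hz1.le,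
    mul_one] at hM
  set m := ∫ x, max x z ∂H.law with hm
  -- For μ = 1 the strict inequality `hM` reads m < 1, whereas m is at least the mean 1.
  have hμ1' : μ < 1 := by
    refine lt_of_le_of_ne hμ1 fun h => ?_
    have hi : Integrable (fun x : ℝ => x) H.law := by
      refine (integrable_max_const H.law_compl_Icc 0).congr ?_
      filter_upwards [ae_mem_Icc_of_compl_null H.law_compl_Icc] with x hx
      exact max_eq_left hx.1
    have : ∫ x, x ∂H.law ≤ m :=
      integral_mono hi (integrable_max_const H.law_compl_Icc z) fun x => le_max_left x z
    rw [hmean] at this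
    rw [h] at hM this
    linarith
  -- The lower bound says (1 - q)z + q > m: the two-point law with mean q still beats H at z. The
  -- upper bound leaves the slack μ - q in the mean.
  obtain ⟨q, hq, hqμ⟩ : ∃ q, (m - z) / (1 - z) < q ∧ q < μ := by
    apply exists_between
    rw [div_lt_iff₀ (by linarith)]
    linarith
  have hq0 : 0 < q := lt_trans (div_pos (by linarith) (by linarith)) hq
  rw [div_lt_iff₀ (by linarith)] at hq
  -- This threshold means 1 - θ < θ(1 - μ), which keeps the shift δ below at most 1.
  refine ⟨1 / (2 - μ), by rw [div_lt_one (by linarith)]; linarith, fun θ hθ hθ1 => ?_⟩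
  rw [div_lt_iff₀ (by linarith)] at hθ
  have hθ0 : 0 < θ := by nlinarith
  have hd : 0 < θ * (1 - μ) := mul_pos hθ0 (by linarith)
  -- Solves θ(μ + δ(1 - μ)) + (1 - θ)q = μ, so that the mixture has mean μ.
  set δ := (μ - q) * (1 - θ) / (θ * (1 - μ)) with hδ
  have hδ0 : 0 < δ := div_pos (mul_pos (by linarith) (by linarith)) hd
  have hδ1 : δ ≤ 1 := by
    rw [hδ, div_le_one hd]
    nlinarith
  have hδeq : δ * (θ * (1 - μ)) = (μ - q) * (1 - θ) := by
    rw [hδ, div_mul_cancel₀ _ hd.ne']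
  set T : ℝ → ℝ := fun x => x + δ * (1 - x) with hT
  have hTm : Measurable T := by fun_prop
  have hTI : ∀ x ∈ Icc (0 : ℝ) 1, T x ∈ Icc (0 : ℝ) 1 := by
    rintro x ⟨h0, h1⟩
    constructor
    · have := mul_nonneg hδ0.le (sub_nonneg.2 h1)
      show 0 ≤ x + δ * (1 - x)
      linarith
    · show x + δ * (1 - x) ≤ 1
      nlinarith
  have := isProbabilityMeasure_priorLaw hq0.le (hqμ.le.trans hμ1)
  have hpm : IsProbabilityMeasure (H.law.map T) := Measure.isProbabilityMeasure_map hTm.aemeasurable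
  have hsuppT : (H.law.map T) (Icc (0 : ℝ) 1)ᶜ = 0 := by
    rw [Measure.map_apply hTm measurableSet_Icc.compl]
    refine measure_mono_null (fun x hx hx' => hx (hTI x hx')) H.law_compl_Icc
  set G := ENNReal.ofReal θ • (H.law.map T) + ENNReal.ofReal (1 - θ) • priorLaw q with hG
  have hGp : IsProbabilityMeasure G := by
    constructor
    simp only [hG, Measure.coe_add, Measure.coe_smul, Pi.add_apply, Pi.smul_apply,
      measure_univ, smul_eq_mul, mul_one]
    rw [← ENNReal.ofReal_add hθ0.le (by linarith)]
    simp
  have hGs : G (Icc (0 : ℝ) 1)ᶜ = 0 := by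
    simp only [hG, Measure.coe_add, Measure.coe_smul, Pi.add_apply, Pi.smul_apply, hsuppT,
      priorLaw_compl_Icc]
    simp
  have hGint : ∀ f : ℝ → ℝ, Measurable f → (∀ x ∈ Icc (0 : ℝ) 1, |f x| ≤ 1) →
      ∫ x, f x ∂G = θ * ∫ x, f (T x) ∂H.law + (1 - θ) * ((1 - q) * f 0 + q * f 1) := by
    intro f hf hb
    have hi : ∀ (K : Measure ℝ) [IsProbabilityMeasure K], K (Icc (0 : ℝ) 1)ᶜ = 0 →
        Integrable f K := by
      intro K _ hK
      refine Integrable.of_bound (C := 1) hf.aestronglyMeasurable ?_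
      filter_upwards [ae_mem_Icc_of_compl_null hK] with x hx
      exact hb x hx
    rw [hG, integral_add_measure ((hi _ hsuppT).smul_measure (by simp))
      ((hi _ (priorLaw_compl_Icc q)).smul_measure (by simp)), integral_smul_measure,
      integral_smul_measure, integral_priorLaw hq0.le (hqμ.le.trans hμ1) hf,
      integral_map hTm.aemeasurable hf.aestronglyMeasurable,
      ENNReal.toReal_ofReal hθ0.le, ENNReal.toReal_ofReal (by linarith), smul_eq_mul, smul_eq_mul]
  have hHi : Integrable (fun x : ℝ => x) H.law := by
    refine (integrable_max_const H.law_compl_Icc 0).congr ?_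
    filter_upwards [ae_mem_Icc_of_compl_null H.law_compl_Icc] with x hx
    exact max_eq_left hx.1
  have hGmean : ∫ x, x ∂G = μ := by
    rw [hGint (fun x => x) measurable_id fun x hx => abs_le.2 ⟨by linarith [hx.1], hx.2⟩]
    have : ∫ x, T x ∂H.law = μ + δ * (1 - μ) := by
      have h1 : ∫ x, T x ∂H.law = ∫ x, (δ + (1 - δ) * x) ∂H.law := by
        congr 1; ext x; simp only [hT]; ring
      rw [h1, integral_add (integrable_const _) (hHi.const_mul _), integral_const_mul, hmean,
        integral_const, probReal_univ, one_smul]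
      ring
    rw [this]
    linear_combination hδeq
  have hGz : z < reservationPrice c β G := by
    refine reservationPrice_lt_of_integral_max_lt H.law_compl_Icc hGs hc hβ0 hβ1 hfric ?_
    rw [← hz, ← hm, hGint (fun x => max x z) (by fun_prop) fun x hx => by
      rw [abs_of_nonneg (le_max_of_le_left hx.1)]; exact max_le hx.2 hz1.le]
    simp only [max_eq_right hz0.le, max_eq_left hz1.le]
    have h1 : m ≤ ∫ x, max (T x) z ∂H.law := by
      refine integral_mono_ae (integrable_max_const H.law_compl_Icc z) ?_ ?_
      · refine Integrable.of_bound (C := 1) (by fun_prop) ?_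
        filter_upwards [ae_mem_Icc_of_compl_null H.law_compl_Icc] with x hx
        rw [Real.norm_eq_abs, abs_of_nonneg (le_max_of_le_right hz0.le)]
        exact max_le (hTI x hx).2 hz1.le
      · filter_upwards [ae_mem_Icc_of_compl_null H.law_compl_Icc] with x hx
        refine max_le_max_right _ ?_
        show x ≤ x + δ * (1 - x)
        linarith [mul_nonneg hδ0.le (sub_nonneg.2 hx.2)]
    have h2 := mul_le_mul_of_nonneg_left h1 hθ0.le
    have h3 : (1 - θ) * m < (1 - θ) * ((1 - q) * z + q * 1) :=
      mul_lt_mul_of_pos_left (by linarith) (by linarith)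
    linarith
  refine ⟨PureStrategy.ofMeasure G hGs hGmean, T, hTm, ?_, hGz, ?_⟩
  · rw [PureStrategy.law_ofMeasure, hG]
    exact Measure.le_add_right le_rfl
  · rintro x ⟨hx0, hx1⟩
    rw [PureStrategy.law_ofMeasure]
    refine lt_min ?_ (lt_of_le_of_lt (min_le_right _ _) hGz)
    rcases hx1.lt_or_eq with h | h
    · refine lt_of_le_of_lt (min_le_left _ _) ?_
      show x < x + δ * (1 - x)
      linarith [mul_pos hδ0 (sub_pos.2 h)]
    -- The shift fixes the reward 1, but there the truncation binds, and z < 1 suffices.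
    · refine lt_of_le_of_lt (min_le_right _ _) ?_
      simp only [hT, h]
      linarith

/-! ### The value function of the search problem -/

theorem Measurable.integrableOn_Icc_of_abs_le_one {f : ℝ → ℝ} (hf : Measurable f)
    (hb : ∀ m, |f m| ≤ 1) : IntegrableOn f (Icc (0 : ℝ) 1) :=
  Integrable.of_bound (C := 1) hf.aestronglyMeasurable (ae_of_all _ hb)

theorem intervalIntegral_eq_setIntegral_ite {f : ℝ → ℝ} {w : ℝ} (h0 : 0 ≤ w) (h1 : w ≤ 1) :
    ∫ m in w..1, f m = ∫ m in Icc (0 : ℝ) 1, if w ≤ m then f m else 0 := by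
  have h2 : (fun m => if w ≤ m then f m else 0) = (Ici w).indicator f := by
    ext m; simp [indicator]
  have h3 : Icc (0 : ℝ) 1 ∩ Ici w = Icc w 1 := by
    ext m
    simp only [mem_inter_iff, mem_Icc, mem_Ici]
    constructor
    · rintro ⟨⟨_, h⟩, h'⟩; exact ⟨h', h⟩
    · rintro ⟨h, h'⟩; exact ⟨⟨h0.trans h, h'⟩, h⟩
  rw [h2, setIntegral_indicator measurableSet_Ici, h3, intervalIntegral.integral_of_le h1,
    integral_Icc_eq_integral_Ioc]

/-- The integrand vanishes almost everywhere, hence somewhere in every nondegenerate interval.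
Applied to the gap functions below, this turns a zero loss into an inequality between prices. -/
theorem exists_zero_of_setIntegral_eq_zero {f : ℝ → ℝ} (hf : IntegrableOn f (Icc (0 : ℝ) 1))
    (h0 : ∀ m, 0 ≤ f m) (h : ∫ m in Icc (0 : ℝ) 1, f m = 0) {a b : ℝ} (ha : 0 ≤ a) (hab : a < b)
    (hb : b ≤ 1) : ∃ m ∈ Ioo a b, f m = 0 := by
  have h1 : f =ᵐ[volume.restrict (Icc (0 : ℝ) 1)] 0 :=
    (setIntegral_eq_zero_iff_of_nonneg_ae (ae_of_all _ h0) hf).1 h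
  have hsub : Ioo a b ⊆ Icc (0 : ℝ) 1 := fun m hm => ⟨ha.trans hm.1.le, hm.2.le.trans hb⟩
  have h2 : ∀ᵐ m ∂(volume.restrict (Ioo a b)), f m = 0 :=
    ae_restrict_of_ae_restrict_of_subset hsub h1
  have h3 := ae_iff.1 ((ae_restrict_iff' measurableSet_Ioo).1 h2)
  by_contra hne
  push Not at hne
  have h4 : volume (Ioo a b) = 0 :=
    measure_mono_null (show Ioo a b ⊆ {m | ¬(m ∈ Ioo a b → f m = 0)} from
      fun m hm hm' => hne m hm (hm' hm)) h3
  rw [Real.volume_Ioo] at h4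
  simp only [ENNReal.ofReal_eq_zero] at h4
  linarith

theorem measurable_real_Iic (F : Measure ℝ) [IsFiniteMeasure F] :
    Measurable fun m => F.real (Iic m) :=
  (show Monotone fun m => F.real (Iic m) from
    fun _ _ h => measureReal_mono (Iic_subset_Iic.2 h)).measurable

/-- Averaging the lower limit of an integral over a distribution on `[0, 1]`. -/
theorem integral_intervalIntegral_max {F : Measure ℝ} [IsProbabilityMeasure F]
    (hF : F (Icc (0 : ℝ) 1)ᶜ = 0) {P : ℝ → ℝ} (hP : Measurable P) (hb : ∀ m, |P m| ≤ 1) {w : ℝ}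
    (h0 : 0 ≤ w) (h1 : w ≤ 1) :
    ∫ x, (∫ m in (max x w)..1, P m) ∂F =
      ∫ m in Icc (0 : ℝ) 1, if w ≤ m then F.real (Iic m) * P m else 0 := by
  have h2 : ∫ x, (∫ m in (max x w)..1, P m) ∂F =
      ∫ x, (∫ m in Icc (0 : ℝ) 1, if max x w ≤ m then P m else 0) ∂F := by
    refine integral_congr_ae ?_
    filter_upwards [ae_mem_Icc_of_compl_null hF] with x hx
    exact intervalIntegral_eq_setIntegral_ite (le_max_of_le_right h0) (max_le hx.2 h1)
  -- After the swap, max(x, w) ≤ m splits into x ≤ m, which integrates to F(m), and w ≤ m.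
  rw [h2, integral_integral_swap]
  · congr 1
    ext m
    have h3 : (fun x => if max x w ≤ m then P m else 0) =
        (Iic m).indicator fun _ => if w ≤ m then P m else 0 := by
      ext x
      by_cases hx : x ≤ m <;> by_cases hw : w ≤ m <;> simp [hx, hw]
    rw [h3, integral_indicator_const _ measurableSet_Iic]
    split_ifs <;> simp
  · refine Integrable.of_bound (C := 1) ?_ (ae_of_all _ fun p => ?_)
    · refine Measurable.aestronglyMeasurable ?_
      refine Measurable.ite (measurableSet_le (by fun_prop) measurable_snd)
        (hP.comp measurable_snd) measurable_const
    · simp only [Function.uncurry, Real.norm_eq_abs]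
      split_ifs
      · exact hb _
      · simp

theorem integral_max_eq {F : Measure ℝ} [IsProbabilityMeasure F]
    (hF : F (Icc (0 : ℝ) 1)ᶜ = 0) {w : ℝ} (h0 : 0 ≤ w) (h1 : w ≤ 1) :
    ∫ x, max x w ∂F = 1 - ∫ m in Icc (0 : ℝ) 1, if w ≤ m then F.real (Iic m) else 0 := by
  have h2 := integral_intervalIntegral_max hF (P := fun _ => 1) measurable_const (by simp) h0 h1
  simp only [intervalIntegral.integral_const, smul_eq_mul, mul_one] at h2
  rw [integral_sub (integrable_const _) (integrable_max_const hF w), integral_const,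
    probReal_univ, one_smul] at h2
  linarith

/-- The data of Pandora's search problem: costs, and boxes with rewards in `[0, 1]` and positive
reservation prices `z`. -/
structure IsSearchProblem {n : ℕ} (c β : ℝ) (F : Fin n → Measure ℝ) (z : Fin n → ℝ) : Prop where
  cost_nonneg : 0 ≤ c
  discount_pos : 0 < β
  discount_le_one : β ≤ 1
  prob : ∀ j, IsProbabilityMeasure (F j)
  supp : ∀ j, F j (Icc (0 : ℝ) 1)ᶜ = 0
  price_eq : ∀ j, z j = -c + β * ∫ x, max x (z j) ∂(F j)
  price_pos : ∀ j, 0 < z j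
  price_lt_one : ∀ j, z j < 1
  measure_Ioi_pos : ∀ j, 0 < F j (Ioi (z j))

/-- The derivative in the outside option of the value of the search problem with one box. -/
noncomputable def boxSlope (β : ℝ) (F : Measure ℝ) (z m : ℝ) : ℝ :=
  if m < z then β * F.real (Iic m) else 1

/-- The derivative in the outside option of the value of the search problem. -/
noncomputable def searchSlope {n : ℕ} (β : ℝ) (F : Fin n → Measure ℝ) (z : Fin n → ℝ)
    (S : Finset (Fin n)) (m : ℝ) : ℝ := ∏ j ∈ S, boxSlope β (F j) (z j) m

/-- The value of the search problem with closed boxes `S` and outside option `w`. -/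
noncomputable def searchValue {n : ℕ} (β : ℝ) (F : Fin n → Measure ℝ) (z : Fin n → ℝ)
    (S : Finset (Fin n)) (w : ℝ) : ℝ := 1 - ∫ m in w..1, searchSlope β F z S m

namespace IsSearchProblem

variable {n : ℕ} {c β : ℝ} {F : Fin n → Measure ℝ} {z : Fin n → ℝ}

theorem discount_mul_mem (hP : IsSearchProblem c β F z) (j : Fin n) (m : ℝ) :
    0 ≤ β * (F j).real (Iic m) ∧ β * (F j).real (Iic m) ≤ 1 := by
  have := hP.prob j
  have h1 : (F j).real (Iic m) ≤ 1 := measureReal_le_one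
  have h0 : 0 ≤ (F j).real (Iic m) := measureReal_nonneg
  have hb := hP.discount_pos
  have hb1 := hP.discount_le_one
  exact ⟨mul_nonneg hb.le h0, by nlinarith⟩

/-- Some of the mass of F_j above z_j lies above a number t > z_j. The strict inequality thus
extends slightly beyond z_j, where `visitGap` is tested. -/
theorem discount_mul_lt_one (hP : IsSearchProblem c β F z) (j : Fin n) :
    ∃ t > z j, ∀ m < t, β * (F j).real (Iic m) < 1 := by
  have := hP.prob j
  have hpos := hP.measure_Ioi_pos j
  obtain ⟨t, ht, htp⟩ : ∃ t > z j, 0 < F j (Ioi t) := by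
    by_contra hne
    push Not at hne
    have hU : Ioi (z j) ⊆ ⋃ k : ℕ, Ioi (z j + 1 / ((k : ℝ) + 1)) := by
      intro x hx
      obtain ⟨k, hk⟩ := exists_nat_one_div_lt (sub_pos.2 (mem_Ioi.1 hx))
      exact mem_iUnion.2 ⟨k, by rw [mem_Ioi]; linarith⟩
    have h0 : F j (⋃ k : ℕ, Ioi (z j + 1 / ((k : ℝ) + 1))) = 0 :=
      measure_iUnion_null fun k => nonpos_iff_eq_zero.1
        (hne _ (by have : 0 < 1 / ((k : ℝ) + 1) := by positivity
                   linarith))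
    exact hpos.ne' (measure_mono_null hU h0)
  refine ⟨t, ht, fun m hm => ?_⟩
  have h1 : (F j).real (Iic m) ≤ (F j).real (Iic t) :=
    measureReal_mono (Iic_subset_Iic.2 hm.le)
  have h2 : (F j).real (Ioi t) = 1 - (F j).real (Iic t) := by
    rw [← compl_Iic, probReal_compl_eq_one_sub measurableSet_Iic]
  have h3 : 0 < (F j).real (Ioi t) := ENNReal.toReal_pos htp.ne' (measure_ne_top _ _)
  have hb := hP.discount_pos
  have hb1 := hP.discount_le_one
  have h0 : 0 ≤ (F j).real (Iic m) := measureReal_nonneg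
  nlinarith

theorem boxSlope_mem (hP : IsSearchProblem c β F z) (j : Fin n) (m : ℝ) :
    0 ≤ boxSlope β (F j) (z j) m ∧ boxSlope β (F j) (z j) m ≤ 1 := by
  unfold boxSlope
  split_ifs
  · exact hP.discount_mul_mem j m
  · exact ⟨zero_le_one, le_rfl⟩

theorem measurable_boxSlope (hP : IsSearchProblem c β F z) (j : Fin n) :
    Measurable (boxSlope β (F j) (z j)) := by
  have := hP.prob j
  exact Measurable.ite measurableSet_Iio ((measurable_real_Iic (F j)).const_mul β) measurable_const

theorem searchSlope_mem (hP : IsSearchProblem c β F z) (S : Finset (Fin n)) (m : ℝ) :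
    0 ≤ searchSlope β F z S m ∧ searchSlope β F z S m ≤ 1 :=
  ⟨Finset.prod_nonneg fun j _ => (hP.boxSlope_mem j m).1,
    Finset.prod_le_one (fun j _ => (hP.boxSlope_mem j m).1) fun j _ => (hP.boxSlope_mem j m).2⟩

theorem measurable_searchSlope (hP : IsSearchProblem c β F z) (S : Finset (Fin n)) :
    Measurable (searchSlope β F z S) :=
  Finset.measurable_fun_prod S fun j _ => hP.measurable_boxSlope j

theorem searchSlope_le_boxSlope (hP : IsSearchProblem c β F z) {S : Finset (Fin n)} {j : Fin n}
    (hj : j ∈ S) (m : ℝ) : searchSlope β F z S m ≤ boxSlope β (F j) (z j) m := by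
  unfold searchSlope
  rw [← Finset.mul_prod_erase S _ hj]
  exact mul_le_of_le_one_right (hP.boxSlope_mem j m).1
    (Finset.prod_le_one (fun j _ => (hP.boxSlope_mem j m).1) fun j _ => (hP.boxSlope_mem j m).2)

theorem searchSlope_eq_one {S : Finset (Fin n)} {m : ℝ} (h : ∀ l ∈ S, z l ≤ m) :
    searchSlope β F z S m = 1 :=
  Finset.prod_eq_one fun l hl => if_neg (not_lt.2 (h l hl))

theorem searchSlope_lt_one (hP : IsSearchProblem c β F z) {S : Finset (Fin n)} {j : Fin n}
    (hj : j ∈ S) {m : ℝ} (hm : m < z j) : searchSlope β F z S m < 1 := by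
  obtain ⟨t, ht, h⟩ := hP.discount_mul_lt_one j
  refine (hP.searchSlope_le_boxSlope hj m).trans_lt ?_
  rw [boxSlope, if_pos hm]
  exact h m (hm.trans ht)

/-- The excess of the value of the problem over the outside option. -/
noncomputable def stopGap (β : ℝ) (F : Fin n → Measure ℝ) (z : Fin n → ℝ) (S : Finset (Fin n))
    (w m : ℝ) : ℝ := if w ≤ m then 1 - searchSlope β F z S m else 0

/-- The excess of the value of the problem over the value of inspecting box `i`. -/
noncomputable def visitGap (β : ℝ) (F : Fin n → Measure ℝ) (z : Fin n → ℝ) (S : Finset (Fin n))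
    (i : Fin n) (w m : ℝ) : ℝ :=
  if z i ≤ m then (1 - β * (F i).real (Iic m)) *
    (1 - if w ≤ m then searchSlope β F z (S.erase i) m else 0) else 0

theorem stopGap_mem (hP : IsSearchProblem c β F z) (S : Finset (Fin n)) (w m : ℝ) :
    0 ≤ stopGap β F z S w m ∧ stopGap β F z S w m ≤ 1 := by
  have := hP.searchSlope_mem S m
  unfold stopGap
  split_ifs
  · constructor <;> linarith
  · simp

theorem integrableOn_of_mem {f : ℝ → ℝ} (hf : Measurable f) (hb : ∀ m, 0 ≤ f m ∧ f m ≤ 1) :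
    IntegrableOn f (Icc (0 : ℝ) 1) :=
  hf.integrableOn_Icc_of_abs_le_one fun m => by rw [abs_of_nonneg (hb m).1]; exact (hb m).2

theorem integrableOn_stopGap (hP : IsSearchProblem c β F z) (S : Finset (Fin n)) (w : ℝ) :
    IntegrableOn (stopGap β F z S w) (Icc (0 : ℝ) 1) :=
  integrableOn_of_mem (Measurable.ite measurableSet_Ici
    (measurable_const.sub (hP.measurable_searchSlope S)) measurable_const) (hP.stopGap_mem S w)

theorem visitGap_mem (hP : IsSearchProblem c β F z) (S : Finset (Fin n)) (i : Fin n) (w m : ℝ) :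
    0 ≤ visitGap β F z S i w m ∧ visitGap β F z S i w m ≤ 1 := by
  have h1 := hP.searchSlope_mem (S.erase i) m
  have h2 := hP.discount_mul_mem i m
  unfold visitGap
  split_ifs
  · exact ⟨mul_nonneg (by linarith) (by linarith),
      mul_le_one₀ (by linarith) (by linarith) (by linarith)⟩
  · exact ⟨mul_nonneg (by linarith) (by linarith),
      mul_le_one₀ (by linarith) (by linarith) (by linarith)⟩
  · simp

theorem integrableOn_visitGap (hP : IsSearchProblem c β F z) (S : Finset (Fin n)) (i : Fin n)
    (w : ℝ) : IntegrableOn (visitGap β F z S i w) (Icc (0 : ℝ) 1) := by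
  have := hP.prob i
  refine integrableOn_of_mem (Measurable.ite measurableSet_Ici (Measurable.mul ?_ ?_)
    measurable_const) (hP.visitGap_mem S i w)
  · exact measurable_const.sub ((measurable_real_Iic (F i)).const_mul β)
  · exact measurable_const.sub (Measurable.ite measurableSet_Ici (hP.measurable_searchSlope _)
      measurable_const)

theorem setIntegral_ite_one {w : ℝ} (h0 : 0 ≤ w) (h1 : w ≤ 1) :
    ∫ m in Icc (0 : ℝ) 1, (if w ≤ m then (1 : ℝ) else 0) = 1 - w := by
  rw [← intervalIntegral_eq_setIntegral_ite h0 h1]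
  simp

theorem searchValue_sub_self (hP : IsSearchProblem c β F z) (S : Finset (Fin n)) {w : ℝ}
    (h0 : 0 ≤ w) (h1 : w ≤ 1) :
    searchValue β F z S w - w = ∫ m in Icc (0 : ℝ) 1, stopGap β F z S w m := by
  have hi : IntegrableOn (fun m => if w ≤ m then (1 : ℝ) else 0) (Icc (0 : ℝ) 1) :=
    integrableOn_of_mem (Measurable.ite measurableSet_Ici measurable_const measurable_const)
      fun m => by split_ifs <;> simp
  have hi2 : IntegrableOn (fun m => if w ≤ m then searchSlope β F z S m else 0) (Icc (0 : ℝ) 1) :=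
    integrableOn_of_mem (Measurable.ite measurableSet_Ici (hP.measurable_searchSlope S)
      measurable_const) fun m => by
        split_ifs
        · exact hP.searchSlope_mem S m
        · simp
  have h2 : ∀ m, stopGap β F z S w m =
      (if w ≤ m then (1 : ℝ) else 0) - if w ≤ m then searchSlope β F z S m else 0 := by
    intro m; unfold stopGap; split_ifs <;> simp
  simp_rw [h2]
  rw [integral_sub hi hi2, setIntegral_ite_one h0 h1, searchValue,
    intervalIntegral_eq_setIntegral_ite h0 h1]
  ring

theorem integrable_searchValue (hP : IsSearchProblem c β F z) (S : Finset (Fin n)) (j : Fin n)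
    {w : ℝ} (h0 : 0 ≤ w) (h1 : w ≤ 1) :
    Integrable (fun v => searchValue β F z S (max v w)) (F j) := by
  have := hP.prob j
  have hint : ∀ a b : ℝ, IntervalIntegrable (searchSlope β F z S) volume a b := fun a b => by
    rw [intervalIntegrable_iff]
    have : IsFiniteMeasure (volume.restrict (uIoc a b)) := ⟨by simp [uIoc]⟩
    exact Integrable.of_bound (C := 1) (hP.measurable_searchSlope S).aestronglyMeasurable
      (ae_of_all _ fun m => by
        rw [Real.norm_eq_abs, abs_of_nonneg (hP.searchSlope_mem S m).1]
        exact (hP.searchSlope_mem S m).2)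
  have hc : Continuous fun v : ℝ => searchValue β F z S (max v w) := by
    have : Continuous fun v => ∫ m in (1 : ℝ)..v, searchSlope β F z S m :=
      intervalIntegral.continuous_primitive hint 1
    have h2 : (fun v : ℝ => searchValue β F z S (max v w)) =
        fun v => 1 + ∫ m in (1 : ℝ)..(max v w), searchSlope β F z S m := by
      ext v
      rw [searchValue, intervalIntegral.integral_symm]
      ring
    rw [h2]
    exact continuous_const.add (this.comp (continuous_id.max continuous_const))
  refine Integrable.of_bound (C := 2) hc.aestronglyMeasurable ?_
  filter_upwards [ae_mem_Icc_of_compl_null (hP.supp j)] with v hv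
  have hv0 : 0 ≤ max v w := le_max_of_le_right h0
  have hv1 : max v w ≤ 1 := max_le hv.2 h1
  have h3 := hP.searchValue_sub_self S hv0 hv1
  have h4 : 0 ≤ ∫ m in Icc (0 : ℝ) 1, stopGap β F z S (max v w) m :=
    integral_nonneg fun m => (hP.stopGap_mem S _ m).1
  have h5 : ∫ m in Icc (0 : ℝ) 1, stopGap β F z S (max v w) m ≤ ∫ m in Icc (0 : ℝ) 1, (1 : ℝ) :=
    integral_mono (hP.integrableOn_stopGap S _) (integrable_const _)
      fun m => (hP.stopGap_mem S _ m).2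
  simp only [integral_const, measureReal_restrict_apply_univ, Real.volume_real_Icc] at h5
  norm_num at h5
  rw [Real.norm_eq_abs, abs_le]
  constructor <;> linarith

/-- The price equation amounts to ∫_{z_i}^1 (1 - βF_i) = 1 + c - β, and averaging over the reward of
box i multiplies the integrand of the value by F_i. Below z_i the slope of box i is βF_i and
everything cancels; what remains lives on m ≥ z_i. -/
theorem searchValue_sub_visit (hP : IsSearchProblem c β F z) {S : Finset (Fin n)} {i : Fin n}
    (hi : i ∈ S) {w : ℝ} (h0 : 0 ≤ w) (h1 : w ≤ 1) :
    searchValue β F z S w -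
        (-c + β * ∫ v, searchValue β F z (S.erase i) (max v w) ∂(F i)) =
      ∫ m in Icc (0 : ℝ) 1, visitGap β F z S i w m := by
  have := hP.prob i
  have hz0 := (hP.price_pos i).le
  have hz1 := (hP.price_lt_one i).le
  set P := searchSlope β F z (S.erase i) with hPdef
  have hPm : Measurable P := hP.measurable_searchSlope _
  have hPb : ∀ m, 0 ≤ P m ∧ P m ≤ 1 := hP.searchSlope_mem _
  have hFm := measurable_real_Iic (F i)
  have hFb : ∀ m, 0 ≤ (F i).real (Iic m) ∧ (F i).real (Iic m) ≤ 1 := fun m =>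
    ⟨measureReal_nonneg, measureReal_le_one⟩
  have hint : ∀ (f : ℝ → ℝ) (t : ℝ), Measurable f → (∀ m, 0 ≤ f m ∧ f m ≤ 1) →
      IntegrableOn (fun m => if t ≤ m then f m else 0) (Icc (0 : ℝ) 1) := by
    intro f t hf hb
    refine integrableOn_of_mem (Measurable.ite measurableSet_Ici hf measurable_const) fun m => ?_
    split_ifs
    · exact hb m
    · simp
  have e1 : ∫ v, searchValue β F z (S.erase i) (max v w) ∂(F i) =
      1 - ∫ m in Icc (0 : ℝ) 1, if w ≤ m then (F i).real (Iic m) * P m else 0 := by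
    have hb : ∀ m, |P m| ≤ 1 := fun m => by rw [abs_of_nonneg (hPb m).1]; exact (hPb m).2
    rw [← integral_intervalIntegral_max (hP.supp i) hPm hb h0 h1]
    have h2 := hP.integrable_searchValue (S.erase i) i h0 h1
    have h3 : ∫ v, (∫ m in (max v w)..1, P m) ∂(F i) =
        ∫ v, (1 - searchValue β F z (S.erase i) (max v w)) ∂(F i) := by
      congr 1; ext v; rw [searchValue]; ring
    rw [h3, integral_sub (integrable_const _) h2, integral_const, probReal_univ, one_smul]
    ring
  have e2 : searchValue β F z S w =
      1 - ∫ m in Icc (0 : ℝ) 1, if w ≤ m then boxSlope β (F i) (z i) m * P m else 0 := by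
    rw [searchValue, intervalIntegral_eq_setIntegral_ite h0 h1]
    congr 3
    ext m
    rw [hPdef, searchSlope, searchSlope,
      Finset.mul_prod_erase S (fun j => boxSlope β (F j) (z j) m) hi]
  have e3 := hP.price_eq i
  rw [integral_max_eq (hP.supp i) hz0 hz1] at e3
  have e4 := setIntegral_ite_one hz0 hz1
  have e5 : ∀ m, visitGap β F z S i w m =
      ((if z i ≤ m then (1 : ℝ) else 0) - β * (if z i ≤ m then (F i).real (Iic m) else 0)) -
      ((if w ≤ m then boxSlope β (F i) (z i) m * P m else 0) -
        β * (if w ≤ m then (F i).real (Iic m) * P m else 0)) := by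
    intro m
    unfold visitGap boxSlope
    rw [← hPdef]
    by_cases h : z i ≤ m
    · by_cases h' : w ≤ m <;> simp only [h, h', not_lt.2 h, if_true, if_false] <;> ring
    · by_cases h' : w ≤ m <;> simp only [h, h', not_le.1 h, if_true, if_false] <;> ring
  simp_rw [e5]
  have i1 := hint (fun _ => 1) (z i) measurable_const (by simp)
  have i2 := (hint _ (z i) hFm hFb).const_mul β
  have i3 := hint (fun m => boxSlope β (F i) (z i) m * P m) w ((hP.measurable_boxSlope i).mul hPm)
    fun m => ⟨mul_nonneg (hP.boxSlope_mem i m).1 (hPb m).1,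
      mul_le_one₀ (hP.boxSlope_mem i m).2 (hPb m).1 (hPb m).2⟩
  have i4 := (hint (fun m => (F i).real (Iic m) * P m) w (hFm.mul hPm)
    fun m => ⟨mul_nonneg (hFb m).1 (hPb m).1,
      mul_le_one₀ (hFb m).2 (hPb m).1 (hPb m).2⟩).const_mul β
  have hsub : ∀ f g f' g' : ℝ → ℝ, IntegrableOn f (Icc (0 : ℝ) 1) → IntegrableOn g (Icc (0 : ℝ) 1) →
      IntegrableOn f' (Icc (0 : ℝ) 1) → IntegrableOn g' (Icc (0 : ℝ) 1) →
      ∫ m in Icc (0 : ℝ) 1, ((f m - g m) - (f' m - g' m)) =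
        ((∫ m in Icc (0 : ℝ) 1, f m) - ∫ m in Icc (0 : ℝ) 1, g m) -
        ((∫ m in Icc (0 : ℝ) 1, f' m) - ∫ m in Icc (0 : ℝ) 1, g' m) := by
    intro f g f' g' hf hg hf' hg'
    have h3 := integral_sub (hf.sub hg) (hf'.sub hg')
    simp only [Pi.sub_apply] at h3
    rw [h3, integral_sub hf hg, integral_sub hf' hg']
  rw [hsub _ _ _ _ i1 i2 i3 i4, integral_const_mul, integral_const_mul, e4, e1, e2]
  linear_combination e3

theorem le_searchValue (hP : IsSearchProblem c β F z) (S : Finset (Fin n)) {w : ℝ}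
    (h0 : 0 ≤ w) (h1 : w ≤ 1) : w ≤ searchValue β F z S w := by
  have h3 := hP.searchValue_sub_self S h0 h1
  have h4 : 0 ≤ ∫ m in Icc (0 : ℝ) 1, stopGap β F z S w m :=
    integral_nonneg fun m => (hP.stopGap_mem S _ m).1
  linarith

theorem visit_le_searchValue (hP : IsSearchProblem c β F z) {S : Finset (Fin n)} {i : Fin n}
    (hi : i ∈ S) {w : ℝ} (h0 : 0 ≤ w) (h1 : w ≤ 1) :
    -c + β * ∫ v, searchValue β F z (S.erase i) (max v w) ∂(F i) ≤ searchValue β F z S w := by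
  have h3 := hP.searchValue_sub_visit hi h0 h1
  have h4 : 0 ≤ ∫ m in Icc (0 : ℝ) 1, visitGap β F z S i w m :=
    integral_nonneg fun m => (hP.visitGap_mem S _ _ m).1
  linarith

theorem searchValue_eq_self (hP : IsSearchProblem c β F z) {S : Finset (Fin n)} {w : ℝ}
    (h0 : 0 ≤ w) (h1 : w ≤ 1) (h : ∀ l ∈ S, z l ≤ w) : searchValue β F z S w = w := by
  have h3 := hP.searchValue_sub_self S h0 h1
  have h4 : ∀ m, stopGap β F z S w m = 0 := by
    intro m
    unfold stopGap
    split_ifs with hm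
    · rw [searchSlope_eq_one fun l hl => (h l hl).trans hm, sub_self]
    · rfl
  simp_rw [h4, integral_zero] at h3
  linarith

theorem searchValue_eq_visit (hP : IsSearchProblem c β F z) {S : Finset (Fin n)} {i : Fin n}
    (hi : i ∈ S) {w : ℝ} (h0 : 0 ≤ w) (h1 : w ≤ 1) (hw : w ≤ z i) (h : ∀ l ∈ S, z l ≤ z i) :
    -c + β * ∫ v, searchValue β F z (S.erase i) (max v w) ∂(F i) = searchValue β F z S w := by
  have h3 := hP.searchValue_sub_visit hi h0 h1
  have h4 : ∀ m, visitGap β F z S i w m = 0 := by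
    intro m
    unfold visitGap
    split_ifs with hm hm'
    · rw [searchSlope_eq_one fun l hl => (h l (Finset.mem_of_mem_erase hl)).trans hm, sub_self,
        mul_zero]
    · exact absurd (hw.trans hm) hm'
    · rfl
  simp_rw [h4, integral_zero] at h3
  linarith

/-- If w < z_l, the stopping gap would be positive on the whole interval (w, z_l). -/
theorem price_le_of_searchValue_eq_self (hP : IsSearchProblem c β F z) {S : Finset (Fin n)} {w : ℝ}
    (h0 : 0 ≤ w) (h1 : w ≤ 1) (h : searchValue β F z S w = w) {l : Fin n} (hl : l ∈ S) :
    z l ≤ w := by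
  by_contra hlt
  have h3 := hP.searchValue_sub_self S h0 h1
  rw [h, sub_self] at h3
  obtain ⟨m, hm, hm0⟩ := exists_zero_of_setIntegral_eq_zero (hP.integrableOn_stopGap S w)
    (fun m => (hP.stopGap_mem S w m).1) h3.symm h0 (not_le.1 hlt) (hP.price_lt_one l).le
  rw [stopGap, if_pos hm.1.le] at hm0
  linarith [hP.searchSlope_lt_one hl hm.2]

/-- Just above z_i the factor 1 - βF_i is positive. If w or some z_l exceeded z_i, the second factor
of the gap would be positive there too, and inspecting i would be a strict loss. -/
theorem index_rule_of_searchValue_eq_visit (hP : IsSearchProblem c β F z) {S : Finset (Fin n)}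
    {i : Fin n} (hi : i ∈ S) {w : ℝ} (h0 : 0 ≤ w) (h1 : w ≤ 1)
    (h : -c + β * ∫ v, searchValue β F z (S.erase i) (max v w) ∂(F i) = searchValue β F z S w) :
    w ≤ z i ∧ ∀ l ∈ S, z l ≤ z i := by
  have h3 := hP.searchValue_sub_visit hi h0 h1
  rw [h, sub_self] at h3
  obtain ⟨t, ht, htl⟩ := hP.discount_mul_lt_one i
  have key : ∀ b, z i < b → b ≤ 1 → ∃ m ∈ Ioo (z i) (min b t), visitGap β F z S i w m = 0 :=
    fun b hb hb1 => exists_zero_of_setIntegral_eq_zero (hP.integrableOn_visitGap S i w)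
      (fun m => (hP.visitGap_mem S i w m).1) h3.symm (hP.price_pos i).le (lt_min hb ht)
      ((min_le_left _ _).trans hb1)
  constructor
  · by_contra hlt
    obtain ⟨m, ⟨hm1, hm2⟩, hm0⟩ := key w (not_le.1 hlt) h1
    rw [lt_min_iff] at hm2
    rw [visitGap, if_pos hm1.le, if_neg (not_le.2 hm2.1)] at hm0
    linarith [htl m hm2.2]
  · intro l hl
    by_contra hlt
    obtain ⟨m, ⟨hm1, hm2⟩, hm0⟩ := key (z l) (not_le.1 hlt) (hP.price_lt_one l).le
    rw [lt_min_iff] at hm2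
    have hl' : l ∈ S.erase i := Finset.mem_erase.2 ⟨fun e => hlt (by rw [e]), hl⟩
    have h4 := hP.searchSlope_lt_one hl' hm2.1
    rw [visitGap, if_pos hm1.le] at hm0
    have h5 := htl m hm2.2
    refine absurd hm0 (mul_pos (by linarith) ?_).ne'
    split_ifs <;> linarith

end IsSearchProblem

/-! ### Resampling one coordinate of a product measure -/

section Resample

variable {ι X : Type*} [DecidableEq ι] [MeasurableSpace X]

theorem isProbabilityMeasure_update (μ : ι → Measure X) [∀ i, IsProbabilityMeasure (μ i)] (i : ι)
    (ν : Measure X) [IsProbabilityMeasure ν] (j : ι) :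
    IsProbabilityMeasure (Function.update μ i ν j) := by
  by_cases h : j = i
  · subst h; simpa
  · rw [Function.update_of_ne h]; infer_instance

variable [Fintype ι]

/-- Overwriting one coordinate, rather than splitting it off, keeps a single index type. It serves
both for rewards given the laws and for laws given the mixed strategies. -/
theorem map_update_pi_prod (μ : ι → Measure X) [∀ i, IsProbabilityMeasure (μ i)] (i : ι)
    (ν : Measure X) [IsProbabilityMeasure ν] :
    ((Measure.pi μ).prod ν).map (fun p => Function.update p.1 i p.2) =
      Measure.pi (Function.update μ i ν) := by
  have := isProbabilityMeasure_update μ i ν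
  symm
  refine Measure.pi_eq fun s hs => ?_
  rw [Measure.map_apply measurable_update' (MeasurableSet.univ_pi hs)]
  have h1 : (fun p : (ι → X) × X => Function.update p.1 i p.2) ⁻¹' (univ.pi s) =
      (univ.pi (Function.update s i univ)) ×ˢ s i := by
    ext ⟨y, v⟩
    simp only [mem_preimage, mem_pi, mem_univ, true_implies, mem_prod]
    constructor
    · intro h
      refine ⟨fun j => ?_, by simpa using h i⟩
      by_cases hj : j = i
      · subst hj; simp
      · simpa [hj] using h j
    · rintro ⟨h, h'⟩ j
      by_cases hj : j = i
      · subst hj; simpa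
      · simpa [hj] using h j
  rw [h1, Measure.prod_prod, Measure.pi_pi, ← Finset.mul_prod_erase _ _ (Finset.mem_univ i),
    ← Finset.mul_prod_erase _ _ (Finset.mem_univ i)]
  simp only [Function.update_self, measure_univ, one_mul]
  rw [mul_comm]
  congr 1
  refine Finset.prod_congr rfl fun j hj => ?_
  rw [Function.update_of_ne (Finset.ne_of_mem_erase hj),
    Function.update_of_ne (Finset.ne_of_mem_erase hj)]

theorem measurePreserving_update_pi_prod (μ : ι → Measure X) [∀ i, IsProbabilityMeasure (μ i)]
    (i : ι) : MeasurePreserving (fun p : (ι → X) × X => Function.update p.1 i p.2)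
      ((Measure.pi μ).prod (μ i)) (Measure.pi μ) :=
  ⟨measurable_update', by rw [map_update_pi_prod, Function.update_eq_self]⟩

theorem pi_update_apply (μ : ι → Measure X) [∀ i, IsProbabilityMeasure (μ i)] (i : ι)
    (ν : Measure X) [IsProbabilityMeasure ν] {E : Set (ι → X)} (hE : MeasurableSet E) :
    Measure.pi (Function.update μ i ν) E =
      ∫⁻ v, Measure.pi μ {y | Function.update y i v ∈ E} ∂ν := by
  rw [← map_update_pi_prod, Measure.map_apply measurable_update' hE,
    Measure.prod_apply_symm (measurable_update' hE)]
  rfl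

end Resample

/-! ### Sampled rewards -/

section Sampled

variable {n : ℕ} {h : List (Fin n)} {x : Fin n → ℝ}

theorem maxSampled_cons (j : Fin n) (h : List (Fin n)) (x : Fin n → ℝ) :
    maxSampled (j :: h) x = max (x j) (maxSampled h x) := rfl

theorem maxSampled_nonneg (h : List (Fin n)) (x : Fin n → ℝ) : 0 ≤ maxSampled h x := by
  induction h with
  | nil => exact le_rfl
  | cons j h ih => exact le_max_of_le_right ih

theorem le_maxSampled {j : Fin n} (hj : j ∈ h) : x j ≤ maxSampled h x := by
  induction h with
  | nil => simp at hj
  | cons l h ih =>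
    rw [maxSampled_cons]
    rcases List.mem_cons.1 hj with rfl | hj
    · exact le_max_left _ _
    · exact (ih hj).trans (le_max_right _ _)

theorem maxSampled_le_one (hx : ∀ j, x j ∈ Icc (0 : ℝ) 1) : maxSampled h x ≤ 1 := by
  induction h with
  | nil => exact zero_le_one
  | cons j h ih => exact max_le (hx j).2 ih

theorem maxSampled_update {j : Fin n} (hj : j ∉ h) (x : Fin n → ℝ) (v : ℝ) :
    maxSampled (j :: h) (Function.update x j v) = max v (maxSampled h x) := by
  rw [maxSampled_cons, Function.update_self]
  congr 1
  induction h with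
  | nil => rfl
  | cons l h ih =>
    rw [List.mem_cons, not_or] at hj
    rw [maxSampled_cons, maxSampled_cons, ih hj.2, Function.update_of_ne (Ne.symm hj.1)]

theorem measurable_maxSampled (h : List (Fin n)) : Measurable (maxSampled h) := by
  induction h with
  | nil => exact measurable_const
  | cons j h ih => exact (measurable_pi_apply j).max ih

theorem exists_eq_maxSampled (hne : h ≠ []) (hx : ∀ j, 0 ≤ x j) :
    ∃ j ∈ h, x j = maxSampled h x := by
  induction h with
  | nil => exact absurd rfl hne
  | cons j h ih =>
    rw [maxSampled_cons]
    rcases le_total (maxSampled h x) (x j) with h1 | h1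
    · exact ⟨j, by simp, (max_eq_left h1).symm⟩
    · by_cases h2 : h = []
      · subst h2
        exact ⟨j, by simp, (max_eq_left (hx j)).symm⟩
      · obtain ⟨l, hl, hl'⟩ := ih h2
        exact ⟨l, List.mem_cons_of_mem _ hl, by rw [max_eq_right h1, hl']⟩

theorem update_mem_Icc (hx : ∀ j, x j ∈ Icc (0 : ℝ) 1) (j : Fin n) {v : ℝ}
    (hv : v ∈ Icc (0 : ℝ) 1) (l : Fin n) : Function.update x j v l ∈ Icc (0 : ℝ) 1 := by
  by_cases hl : l = j
  · subst hl; simpa using hv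
  · simpa [hl] using hx l

/-- The boxes that are closed at the history `h`. -/
def closedBoxes (h : List (Fin n)) : Finset (Fin n) := h.toFinsetᶜ

theorem mem_closedBoxes {j : Fin n} : j ∈ closedBoxes h ↔ j ∉ h := by simp [closedBoxes]

theorem closedBoxes_cons (j : Fin n) (h : List (Fin n)) :
    closedBoxes (j :: h) = (closedBoxes h).erase j := by
  ext l; simp [closedBoxes]

theorem mem_of_length_eq (hn : h.Nodup) (hl : h.length = n) (j : Fin n) : j ∈ h := by
  rw [← List.mem_toFinset, Finset.eq_univ_of_card h.toFinset (by
    rw [List.toFinset_card_of_nodup hn, hl, Fintype.card_fin])]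
  exact Finset.mem_univ j

theorem exists_notMem_of_length_lt (hl : h.length < n) : ∃ j, j ∉ h := by
  by_contra hne
  push Not at hne
  have : h.toFinset = Finset.univ := Finset.eq_univ_iff_forall.2 fun j => List.mem_toFinset.2 (hne j)
  have h2 := List.toFinset_card_le h
  rw [this, Finset.card_univ, Fintype.card_fin] at h2
  omega

end Sampled

/-! ### Convex combinations over the actions at a history. -/

namespace Policy

variable {n : ℕ} (η : Policy n) (h : List (Fin n)) (x : Fin n → ℝ)

theorem stopProb_nonneg : 0 ≤ η.stopProb h x := sub_nonneg.2 (η.sum_visit_le h x)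

theorem stopProb_add_sum_visit : η.stopProb h x + ∑ j, η.visit h x j = 1 := by
  rw [stopProb]; ring

theorem measurable_stopProb : Measurable fun x => η.stopProb h x :=
  measurable_const.sub (Finset.measurable_fun_sum _ fun i _ => η.measurable_visit h i)

/-- A convex combination over the actions at a history is at most a common upper bound of the
values of the actions that are taken. -/
theorem combination_le {a C : ℝ} {b : Fin n → ℝ} (ha : 0 < η.stopProb h x → a ≤ C)
    (hb : ∀ j, 0 < η.visit h x j → b j ≤ C) :
    η.stopProb h x * a + ∑ j, η.visit h x j * b j ≤ C := by
  have h1 : η.stopProb h x * a ≤ η.stopProb h x * C := by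
    rcases (η.stopProb_nonneg h x).eq_or_lt with h0 | h0
    · rw [← h0]; simp
    · exact mul_le_mul_of_nonneg_left (ha h0) h0.le
  have h2 : ∑ j, η.visit h x j * b j ≤ ∑ j, η.visit h x j * C := by
    refine Finset.sum_le_sum fun j _ => ?_
    rcases (η.visit_nonneg h x j).eq_or_lt with h0 | h0
    · rw [← h0]; simp
    · exact mul_le_mul_of_nonneg_left (hb j h0) h0.le
  rw [← Finset.sum_mul] at h2
  calc _ ≤ η.stopProb h x * C + (∑ j, η.visit h x j) * C := add_le_add h1 h2
    _ = C := by rw [← add_mul, stopProb_add_sum_visit, one_mul]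

theorem le_combination {a C : ℝ} {b : Fin n → ℝ} (ha : 0 < η.stopProb h x → C ≤ a)
    (hb : ∀ j, 0 < η.visit h x j → C ≤ b j) :
    C ≤ η.stopProb h x * a + ∑ j, η.visit h x j * b j := by
  have := η.combination_le h x (a := -a) (C := -C) (b := fun j => -b j)
    (fun h => neg_le_neg (ha h)) fun j hj => neg_le_neg (hb j hj)
  simp only [mul_neg, Finset.sum_neg_distrib] at this
  linarith

/-- If a convex combination over the actions attains an upper bound of the values of the actions,
every action that is taken attains it. -/
theorem eq_of_combination_eq {a C : ℝ} {b : Fin n → ℝ} (ha : a ≤ C)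
    (hb : ∀ j, 0 < η.visit h x j → b j ≤ C)
    (heq : η.stopProb h x * a + ∑ j, η.visit h x j * b j = C) :
    (0 < η.stopProb h x → a = C) ∧ ∀ j, 0 < η.visit h x j → b j = C := by
  have h1 : 0 ≤ η.stopProb h x * (C - a) :=
    mul_nonneg (η.stopProb_nonneg h x) (sub_nonneg.2 ha)
  have h2 : ∀ j ∈ Finset.univ, 0 ≤ η.visit h x j * (C - b j) := fun j _ => by
    rcases (η.visit_nonneg h x j).eq_or_lt with h0 | h0
    · rw [← h0]; simp
    · exact mul_nonneg h0.le (sub_nonneg.2 (hb j h0))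
  have h3 : η.stopProb h x * (C - a) + ∑ j, η.visit h x j * (C - b j) = 0 := by
    simp_rw [mul_sub]
    rw [Finset.sum_sub_distrib, ← Finset.sum_mul]
    have := η.stopProb_add_sum_visit h x
    linear_combination C * this - heq
  have h4 := Finset.sum_nonneg h2
  have h5 : ∑ j, η.visit h x j * (C - b j) = 0 := by linarith
  refine ⟨fun h0 => ?_, fun j h0 => ?_⟩
  · have h6 : η.stopProb h x * (C - a) = 0 := by linarith
    linarith [(mul_eq_zero.1 h6).resolve_left h0.ne']
  · have h6 := (Finset.sum_eq_zero_iff_of_nonneg h2).1 h5 j (Finset.mem_univ j)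
    linarith [(mul_eq_zero.1 h6).resolve_left h0.ne']

variable {h x} in
theorem notMem_of_visit_pos {j : Fin n} (hj : 0 < η.visit h x j) : j ∉ h :=
  fun hm => hj.ne' (η.visit_opened h x j hm)

end Policy

/-! ### Selection probabilities -/

section WinProb

variable {n : ℕ}

theorem mem_bestOpened {i : Fin n} {h : List (Fin n)} {x : Fin n → ℝ} :
    i ∈ bestOpened h x ↔ i ∈ h ∧ x i = maxSampled h x := by
  simp [bestOpened]

theorem claimProb_nonneg (i : Fin n) (h : List (Fin n)) (x : Fin n → ℝ) : 0 ≤ claimProb i h x := by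
  unfold claimProb
  split_ifs <;> positivity

theorem sum_claimProb_le_one (h : List (Fin n)) (x : Fin n → ℝ) : ∑ i, claimProb i h x ≤ 1 := by
  classical
  unfold claimProb
  rw [← Finset.sum_filter, Finset.sum_const, nsmul_eq_mul]
  have : (Finset.univ.filter fun i => i ∈ bestOpened h x) = bestOpened h x := by ext; simp
  rw [this]
  rcases eq_or_ne ((bestOpened h x).card : ℝ) 0 with h0 | h0
  · rw [h0]; simp
  · rw [mul_one_div_cancel h0]

theorem claimProb_le_one (i : Fin n) (h : List (Fin n)) (x : Fin n → ℝ) : claimProb i h x ≤ 1 :=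
  (Finset.single_le_sum (fun j _ => claimProb_nonneg j h x) (Finset.mem_univ i)).trans
    (sum_claimProb_le_one h x)

theorem measurable_claimProb (i : Fin n) (h : List (Fin n)) :
    Measurable fun x => claimProb i h x := by
  classical
  have hs : ∀ j : Fin n, MeasurableSet {x : Fin n → ℝ | j ∈ bestOpened h x} := fun j => by
    simp only [mem_bestOpened]
    exact (MeasurableSet.const _).inter
      (measurableSet_eq_fun (measurable_pi_apply j) (measurable_maxSampled h))
  have hcard : ∀ x, ((bestOpened h x).card : ℝ) =
      ∑ j, if j ∈ bestOpened h x then (1 : ℝ) else 0 := fun x => by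
    rw [Finset.sum_ite_mem, Finset.univ_inter, Finset.sum_const, nsmul_eq_mul, mul_one]
  unfold claimProb
  simp_rw [hcard]
  exact Measurable.ite (hs i) (measurable_const.div (Finset.measurable_fun_sum _ fun j _ =>
    Measurable.ite (hs j) measurable_const measurable_const)) measurable_const

/-- The selection probability depends measurably on the distributions, the policy and the sampled
rewards. -/
theorem measurable_winProbAux {α : Type*} [MeasurableSpace α]
    (κ : Fin n → ProbabilityTheory.Kernel α ℝ) [∀ j, ProbabilityTheory.IsMarkovKernel (κ j)]
    (p : α → Policy n)
    (hp : ∀ h i, Measurable fun q : α × (Fin n → ℝ) => (p q.1).visit h q.2 i) (i : Fin n) (k : ℕ) :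
    ∀ h, Measurable fun q : α × (Fin n → ℝ) =>
      winProbAux (fun j => κ j q.1) (p q.1) i k h q.2 := by
  induction k with
  | zero => exact fun h => (measurable_claimProb i h).comp measurable_snd
  | succ k ih =>
    intro h
    simp only [winProbAux]
    refine Measurable.add (Measurable.mul ?_ ((measurable_claimProb i h).comp measurable_snd)) ?_
    · exact measurable_const.sub (Finset.measurable_fun_sum _ fun i _ => hp h i)
    · refine Finset.measurable_fun_sum _ fun j _ => (hp h j).mul ?_
      have h1 : Measurable fun r : (α × (Fin n → ℝ)) × ℝ =>
          winProbAux (fun j => κ j r.1.1) (p r.1.1) i k (j :: h) (Function.update r.1.2 j r.2) :=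
        (ih (j :: h)).comp ((measurable_fst.comp measurable_fst).prodMk
          (measurable_update'.comp ((measurable_snd.comp measurable_fst).prodMk measurable_snd)))
      exact (h1.stronglyMeasurable.integral_kernel_prod_right'
        (κ := (κ j).comap Prod.fst measurable_fst)).measurable

variable (F : Fin n → Measure ℝ) [∀ j, IsProbabilityMeasure (F j)] (η : Policy n)

theorem measurable_winProbAux_reward (i : Fin n) (k : ℕ) (h : List (Fin n)) :
    Measurable fun x => winProbAux F η i k h x :=
  (measurable_winProbAux (α := Unit) (fun j => ProbabilityTheory.Kernel.const Unit (F j))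
    (fun _ => η) (fun h i => (η.measurable_visit h i).comp measurable_snd) i k h).comp
    ((measurable_const (a := ())).prodMk measurable_id)

theorem winProbAux_mem (i : Fin n) (k : ℕ) : ∀ (h : List (Fin n)) (x : Fin n → ℝ),
    0 ≤ winProbAux F η i k h x ∧ winProbAux F η i k h x ≤ 1 := by
  induction k with
  | zero => exact fun h x => ⟨claimProb_nonneg i h x, claimProb_le_one i h x⟩
  | succ k ih =>
    intro h x
    have h1 : ∀ j, ∫ v, winProbAux F η i k (j :: h) (Function.update x j v) ∂(F j) ≤ 1 := fun j => by
      have := integral_mono_of_nonneg (μ := F j) (ae_of_all _ fun v => (ih (j :: h)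
        (Function.update x j v)).1) (integrable_const (1 : ℝ))
        (ae_of_all _ fun v => (ih (j :: h) (Function.update x j v)).2)
      simpa using this
    exact ⟨η.le_combination h x (fun _ => claimProb_nonneg i h x) fun j _ =>
      integral_nonneg fun v => (ih _ _).1,
      η.combination_le h x (fun _ => claimProb_le_one i h x) fun j _ => h1 j⟩

theorem integrable_winProbAux (i j : Fin n) (k : ℕ) (h : List (Fin n)) (x : Fin n → ℝ) :
    Integrable (fun v => winProbAux F η i k h (Function.update x j v)) (F j) := by
  refine Integrable.of_bound (C := 1) ((measurable_winProbAux_reward F η i k h).comp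
    (measurable_update x)).aestronglyMeasurable (ae_of_all _ fun v => ?_)
  rw [Real.norm_eq_abs, abs_of_nonneg (winProbAux_mem F η i k _ _).1]
  exact (winProbAux_mem F η i k _ _).2

/-- At most one box is selected; the uniform choice within O* loses nothing to ties. -/
theorem sum_winProbAux_le_one (k : ℕ) : ∀ (h : List (Fin n)) (x : Fin n → ℝ),
    ∑ i, winProbAux F η i k h x ≤ 1 := by
  induction k with
  | zero => exact fun h x => sum_claimProb_le_one h x
  | succ k ih =>
    intro h x
    simp only [winProbAux]
    rw [Finset.sum_add_distrib, ← Finset.mul_sum, Finset.sum_comm]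
    simp_rw [← Finset.mul_sum]
    refine η.combination_le h x (fun _ => sum_claimProb_le_one h x) fun j _ => ?_
    rw [← integral_finsetSum _ fun i _ => integrable_winProbAux F η i j k (j :: h) x]
    have := integral_mono (μ := F j) (integrable_finsetSum _ fun i _ =>
      integrable_winProbAux F η i j k (j :: h) x) (integrable_const (1 : ℝ))
      fun v => ih (j :: h) (Function.update x j v)
    simpa using this

end WinProb

/-! ### Optimal policies -/

section PandoraValue

variable {n : ℕ} {c β : ℝ} {F : Fin n → Measure ℝ} {z : Fin n → ℝ}

theorem measurable_pandoraValueAux (hP : IsSearchProblem c β F z) (η : Policy n) (k : ℕ) :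
    ∀ h, Measurable fun x => pandoraValueAux c β F η k h x := by
  have := hP.prob
  induction k with
  | zero => exact measurable_maxSampled
  | succ k ih =>
    intro h
    simp only [pandoraValueAux]
    refine ((η.measurable_stopProb h).mul (measurable_maxSampled h)).add
      (Finset.measurable_fun_sum _ fun j _ => (η.measurable_visit h j).mul
        (measurable_const.add (measurable_const.mul ?_)))
    have h1 : Measurable fun p : (Fin n → ℝ) × ℝ =>
        pandoraValueAux c β F η k (j :: h) (Function.update p.1 j p.2) :=
      (ih (j :: h)).comp measurable_update'
    exact h1.stronglyMeasurable.integral_prod_right'.measurable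

theorem abs_pandoraValueAux_le (hP : IsSearchProblem c β F z) (η : Policy n) (k : ℕ) :
    ∀ (h : List (Fin n)) (x : Fin n → ℝ), (∀ j, x j ∈ Icc (0 : ℝ) 1) →
      |pandoraValueAux c β F η k h x| ≤ 1 + k * c := by
  have := hP.prob
  have hc := hP.cost_nonneg
  have hβ := hP.discount_pos
  have hβ1 := hP.discount_le_one
  induction k with
  | zero =>
    intro h x hx
    simp only [pandoraValueAux]
    rw [abs_of_nonneg (maxSampled_nonneg h x)]
    simpa using maxSampled_le_one hx
  | succ k ih =>
    intro h x hx
    have hkc : 0 ≤ (k : ℝ) * c := by positivity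
    have h0 := maxSampled_nonneg h x
    have h1 := maxSampled_le_one (h := h) hx
    have h2 : ∀ j, |(-c + β * ∫ v, pandoraValueAux c β F η k (j :: h)
        (Function.update x j v) ∂(F j))| ≤ 1 + (k + 1 : ℕ) * c := by
      intro j
      have h3 : ‖∫ v, pandoraValueAux c β F η k (j :: h) (Function.update x j v) ∂(F j)‖ ≤
          (1 + k * c) * (F j).real univ :=
        norm_integral_le_of_norm_le_const (by
          filter_upwards [ae_mem_Icc_of_compl_null (hP.supp j)] with v hv
          exact ih _ _ (update_mem_Icc hx j hv))
      rw [probReal_univ, mul_one, Real.norm_eq_abs] at h3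
      rw [abs_le] at h3 ⊢
      push_cast
      constructor <;> nlinarith
    rw [abs_le]
    refine ⟨η.le_combination h x (fun _ => ?_) fun j _ => (abs_le.1 (h2 j)).1,
      η.combination_le h x (fun _ => ?_) fun j _ => (abs_le.1 (h2 j)).2⟩ <;>
    · push_cast
      nlinarith

theorem integrable_pandoraValueAux (hP : IsSearchProblem c β F z) (η : Policy n) (k : ℕ)
    (h : List (Fin n)) {x : Fin n → ℝ} (hx : ∀ j, x j ∈ Icc (0 : ℝ) 1) (j : Fin n) :
    Integrable (fun v => pandoraValueAux c β F η k h (Function.update x j v)) (F j) := by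
  have := hP.prob j
  refine Integrable.of_bound (C := 1 + k * c) ((measurable_pandoraValueAux hP η k h).comp
    (measurable_update x)).aestronglyMeasurable ?_
  filter_upwards [ae_mem_Icc_of_compl_null (hP.supp j)] with v hv
  exact abs_pandoraValueAux_le hP η k h _ (update_mem_Icc hx j hv)

/-- Backward induction: both gaps are nonnegative, so the value function dominates stopping and
every inspection. -/
theorem pandoraValueAux_le (hP : IsSearchProblem c β F z) (η : Policy n) (k : ℕ) :
    ∀ (h : List (Fin n)) (x : Fin n → ℝ), h.Nodup → h.length + k = n →
      (∀ j, x j ∈ Icc (0 : ℝ) 1) →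
      pandoraValueAux c β F η k h x ≤ searchValue β F z (closedBoxes h) (maxSampled h x) := by
  induction k with
  | zero =>
    intro h x hn hl hx
    exact hP.le_searchValue _ (maxSampled_nonneg h x) (maxSampled_le_one hx)
  | succ k ih =>
    intro h x hn hl hx
    have h0 := maxSampled_nonneg h x
    have h1 := maxSampled_le_one (h := h) hx
    refine η.combination_le h x (fun _ => hP.le_searchValue _ h0 h1) fun j hj => ?_
    have hjh := η.notMem_of_visit_pos hj
    refine le_trans ?_ (hP.visit_le_searchValue (mem_closedBoxes.2 hjh) h0 h1)
    refine add_le_add_right (mul_le_mul_of_nonneg_left ?_ hP.discount_pos.le) _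
    refine integral_mono_ae (integrable_pandoraValueAux hP η k _ hx j)
      (hP.integrable_searchValue _ j h0 h1) ?_
    filter_upwards [ae_mem_Icc_of_compl_null (hP.supp j)] with v hv
    have := ih (j :: h) (Function.update x j v) (hn.cons hjh) (by simp; omega)
      (update_mem_Icc hx j hv)
    rwa [maxSampled_update hjh, closedBoxes_cons] at this

theorem bestClosed_nonempty (z : Fin n → ℝ) {h : List (Fin n)} (hl : h.length < n) :
    (bestClosed z h).Nonempty := by
  obtain ⟨j, hj⟩ := exists_notMem_of_length_lt hl
  obtain ⟨i, hi, hmax⟩ := (closedBoxes h).exists_max_image z ⟨j, mem_closedBoxes.2 hj⟩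
  exact ⟨i, mem_closedBoxes.1 hi, fun l hl => hmax l (mem_closedBoxes.2 hl)⟩

open Classical in
/-- The index policy: inspect some closed box with maximal reservation price, as long as that
price exceeds the maximum sampled reward. -/
noncomputable def indexPolicy (z : Fin n → ℝ) : Policy n where
  visit h x i :=
    if (∃ hne : (bestClosed z h).Nonempty, hne.some = i) ∧ maxSampled h x < z i then 1 else 0
  visit_nonneg h x i := by split_ifs <;> simp
  visit_opened h x i hi := by
    refine if_neg ?_
    rintro ⟨⟨hne, rfl⟩, -⟩
    exact hne.some_mem.1 hi
  sum_visit_le h x := by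
    by_cases hne : (bestClosed z h).Nonempty
    · rw [Finset.sum_eq_single hne.some]
      · split_ifs <;> simp
      · rintro j - hj
        refine if_neg ?_
        rintro ⟨⟨_, rfl⟩, -⟩
        exact hj rfl
      · simp
    · rw [Finset.sum_eq_zero]
      · exact zero_le_one
      · rintro j -
        refine if_neg ?_
        rintro ⟨⟨h', _⟩, -⟩
        exact hne h'
  measurable_visit h i := Measurable.ite ((MeasurableSet.const _).inter
    (measurableSet_lt (measurable_maxSampled h) measurable_const)) measurable_const measurable_const

theorem visit_indexPolicy {h : List (Fin n)} (hne : (bestClosed z h).Nonempty) (x : Fin n → ℝ)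
    (i : Fin n) : (indexPolicy z).visit h x i =
      if hne.some = i ∧ maxSampled h x < z i then 1 else 0 := by
  simp only [indexPolicy]
  congr 1
  simp [hne]

/-- Every action of the index policy has zero gap, so the bound of `pandoraValueAux_le` is attained,
and every optimal policy must attain it too. -/
theorem le_pandoraValueAux_indexPolicy (hP : IsSearchProblem c β F z) (k : ℕ) :
    ∀ (h : List (Fin n)) (x : Fin n → ℝ), h.Nodup → h.length + k = n →
      (∀ j, x j ∈ Icc (0 : ℝ) 1) →
      searchValue β F z (closedBoxes h) (maxSampled h x) ≤
        pandoraValueAux c β F (indexPolicy z) k h x := by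
  induction k with
  | zero =>
    intro h x hn hl hx
    refine (hP.searchValue_eq_self (maxSampled_nonneg h x) (maxSampled_le_one hx) ?_).le
    intro l hl'
    exact absurd (mem_of_length_eq hn hl l) (mem_closedBoxes.1 hl')
  | succ k ih =>
    intro h x hn hl hx
    have h0 := maxSampled_nonneg h x
    have h1 := maxSampled_le_one (h := h) hx
    have hne : (bestClosed z h).Nonempty := bestClosed_nonempty z (by omega)
    have hbest := hne.some_mem
    have hmax : ∀ l ∈ closedBoxes h, z l ≤ z hne.some :=
      fun l hl => hbest.2 l (mem_closedBoxes.1 hl)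
    refine (indexPolicy z).le_combination h x (fun hs => ?_) fun j hj => ?_
    · refine (hP.searchValue_eq_self h0 h1 fun l hl => ?_).le
      -- Otherwise the chosen box would be inspected with probability one, leaving no probability of
      -- stopping.
      by_contra hlt
      have hz : maxSampled h x < z hne.some := (not_le.1 hlt).trans_le (hmax l hl)
      have h2 := (indexPolicy z).stopProb_add_sum_visit h x
      have h3 := Finset.single_le_sum (f := fun j => (indexPolicy z).visit h x j)
        (fun j _ => (indexPolicy z).visit_nonneg h x j) (Finset.mem_univ hne.some)
      simp only [visit_indexPolicy hne x hne.some, hz, and_self, if_true] at h3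
      linarith
    · have hjh := (indexPolicy z).notMem_of_visit_pos hj
      rw [visit_indexPolicy hne] at hj
      split_ifs at hj with hc
      · obtain ⟨rfl, hw⟩ := hc
        rw [← hP.searchValue_eq_visit (mem_closedBoxes.2 hjh) h0 h1 hw.le hmax]
        refine add_le_add_right (mul_le_mul_of_nonneg_left ?_ hP.discount_pos.le) _
        refine integral_mono_ae (hP.integrable_searchValue _ _ h0 h1)
          (integrable_pandoraValueAux hP _ k _ hx _) ?_
        filter_upwards [ae_mem_Icc_of_compl_null (hP.supp hne.some)] with v hv
        have := ih (hne.some :: h) (Function.update x hne.some v) (hn.cons hjh) (by simp; omega)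
          (update_mem_Icc hx _ hv)
        rwa [maxSampled_update hjh, closedBoxes_cons] at this
      · exact absurd hj (lt_irrefl _)

theorem pandoraValue_eq_of_isOptimal (hP : IsSearchProblem c β F z) {η : Policy n}
    (hη : η.IsOptimal c β F) : pandoraValueAux c β F η n [] 0 =
      searchValue β F z (closedBoxes []) (maxSampled [] (0 : Fin n → ℝ)) := by
  have h0 : ∀ j, (0 : Fin n → ℝ) j ∈ Icc (0 : ℝ) 1 := fun j => by simp
  exact le_antisymm (pandoraValueAux_le hP η n [] 0 List.nodup_nil (by simp) h0)
    ((le_pandoraValueAux_indexPolicy hP n [] 0 List.nodup_nil (by simp) h0).trans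
      (hη (indexPolicy z)))

/-- A policy that is optimal from a history on stops only when the maximum sampled reward is at
least all reservation prices of closed boxes, inspects only boxes with maximal reservation price,
and remains optimal afterwards. -/
theorem tight_of_pandoraValueAux_eq (hP : IsSearchProblem c β F z) (η : Policy n) {k : ℕ}
    {h : List (Fin n)} {x : Fin n → ℝ} (hn : h.Nodup) (hl : h.length + (k + 1) = n)
    (hx : ∀ j, x j ∈ Icc (0 : ℝ) 1)
    (heq : pandoraValueAux c β F η (k + 1) h x =
      searchValue β F z (closedBoxes h) (maxSampled h x)) :
    (0 < η.stopProb h x → ∀ l, l ∉ h → z l ≤ maxSampled h x) ∧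
    ∀ j, 0 < η.visit h x j → maxSampled h x ≤ z j ∧ (∀ l, l ∉ h → z l ≤ z j) ∧
      ∀ᵐ v ∂(F j), pandoraValueAux c β F η k (j :: h) (Function.update x j v) =
        searchValue β F z (closedBoxes (j :: h)) (maxSampled (j :: h) (Function.update x j v)) := by
  have h0 := maxSampled_nonneg h x
  have h1 := maxSampled_le_one (h := h) hx
  have hae : ∀ j, j ∉ h → ∀ᵐ v ∂(F j), pandoraValueAux c β F η k (j :: h) (Function.update x j v) ≤
      searchValue β F z ((closedBoxes h).erase j) (max v (maxSampled h x)) := by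
    intro j hjh
    filter_upwards [ae_mem_Icc_of_compl_null (hP.supp j)] with v hv
    have := pandoraValueAux_le hP η k (j :: h) (Function.update x j v) (hn.cons hjh)
      (by simp; omega) (update_mem_Icc hx j hv)
    rwa [maxSampled_update hjh, closedBoxes_cons] at this
  have hle : ∀ j, j ∉ h →
      -c + β * ∫ v, pandoraValueAux c β F η k (j :: h) (Function.update x j v) ∂(F j) ≤
      -c + β * ∫ v, searchValue β F z ((closedBoxes h).erase j) (max v (maxSampled h x)) ∂(F j) :=
    fun j hjh => add_le_add_right (mul_le_mul_of_nonneg_left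
      (integral_mono_ae (integrable_pandoraValueAux hP η k _ hx j)
        (hP.integrable_searchValue _ j h0 h1) (hae j hjh)) hP.discount_pos.le) _
  obtain ⟨hs, hv⟩ := η.eq_of_combination_eq h x (hP.le_searchValue _ h0 h1)
    (fun j hj => (hle j (η.notMem_of_visit_pos hj)).trans
      (hP.visit_le_searchValue (mem_closedBoxes.2 (η.notMem_of_visit_pos hj)) h0 h1)) heq
  refine ⟨fun hpos l hlh => hP.price_le_of_searchValue_eq_self h0 h1 (hs hpos).symm
    (mem_closedBoxes.2 hlh), fun j hj => ?_⟩
  have hjh := η.notMem_of_visit_pos hj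
  have e1 := hv j hj
  have e2 := hle j hjh
  have e3 := hP.visit_le_searchValue (mem_closedBoxes.2 hjh) h0 h1
  have e4 := hP.index_rule_of_searchValue_eq_visit (mem_closedBoxes.2 hjh) h0 h1 (by linarith)
  refine ⟨e4.1, fun l hlh => e4.2 l (mem_closedBoxes.2 hlh), ?_⟩
  have e5 : ∫ v, pandoraValueAux c β F η k (j :: h) (Function.update x j v) ∂(F j) =
      ∫ v, searchValue β F z ((closedBoxes h).erase j) (max v (maxSampled h x)) ∂(F j) :=
    mul_left_cancel₀ hP.discount_pos.ne' (by linarith)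
  -- Ordered integrands with equal integrals agree almost everywhere: optimality passes to almost
  -- every continuation.
  have e6 := (integral_eq_iff_of_ae_le (integrable_pandoraValueAux hP η k _ hx j)
    (hP.integrable_searchValue _ j h0 h1) (hae j hjh)).1 e5
  filter_upwards [e6] with v hv
  rw [hv, maxSampled_update hjh, closedBoxes_cons]

end PandoraValue

/-! ### The selected box has the largest truncated reward -/

section Winner

variable {n : ℕ} {c β : ℝ} {F : Fin n → Measure ℝ} {z : Fin n → ℝ}

/-- Reward vectors for which box `i` has a maximal reward among the rewards truncated at the
reservation prices. -/
def weakWin (z : Fin n → ℝ) (i : Fin n) : Set (Fin n → ℝ) :=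
  {y | ∀ j, min (y j) (z j) ≤ min (y i) (z i)}

/-- Reward vectors for which box `i` has the unique maximal reward among the rewards truncated at
the reservation prices. -/
def strictWin (z : Fin n → ℝ) (i : Fin n) : Set (Fin n → ℝ) :=
  {y | ∀ j, j ≠ i → min (y j) (z j) < min (y i) (z i)}

theorem measurableSet_weakWin (z : Fin n → ℝ) (i : Fin n) : MeasurableSet (weakWin z i) := by
  simp only [weakWin, ofPred_forall]
  exact MeasurableSet.iInter fun j => measurableSet_le
    ((measurable_pi_apply j).min measurable_const) ((measurable_pi_apply i).min measurable_const)

theorem measurableSet_strictWin (z : Fin n → ℝ) (i : Fin n) : MeasurableSet (strictWin z i) := by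
  simp only [strictWin, ofPred_forall]
  exact MeasurableSet.iInter fun j => MeasurableSet.iInter fun _ => measurableSet_lt
    ((measurable_pi_apply j).min measurable_const) ((measurable_pi_apply i).min measurable_const)

/-- The reward vector with the sampled rewards `x` at the opened boxes and `y` elsewhere. -/
def completeRewards (h : List (Fin n)) (x y : Fin n → ℝ) : Fin n → ℝ :=
  fun j => if j ∈ h then x j else y j

theorem measurable_completeRewards (h : List (Fin n)) :
    Measurable fun p : (Fin n → ℝ) × (Fin n → ℝ) => completeRewards h p.1 p.2 := by
  refine measurable_pi_lambda _ fun j => ?_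
  unfold completeRewards
  split_ifs
  · exact (measurable_pi_apply j).comp measurable_fst
  · exact (measurable_pi_apply j).comp measurable_snd

/-- The probability that the rewards end up in `E`, given the sampled rewards. -/
noncomputable def condProb (F : Fin n → Measure ℝ) (E : Set (Fin n → ℝ)) (h : List (Fin n))
    (x : Fin n → ℝ) : ℝ := (Measure.pi F).real {y | completeRewards h x y ∈ E}

theorem condProb_mem [∀ j, IsProbabilityMeasure (F j)] (E : Set (Fin n → ℝ)) (h : List (Fin n))
    (x : Fin n → ℝ) : 0 ≤ condProb F E h x ∧ condProb F E h x ≤ 1 :=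
  ⟨measureReal_nonneg, measureReal_le_one⟩

theorem measurable_condProb [∀ j, IsProbabilityMeasure (F j)] {E : Set (Fin n → ℝ)}
    (hE : MeasurableSet E) (h : List (Fin n)) : Measurable (condProb F E h) :=
  (measurable_measure_prodMk_left (measurable_completeRewards h hE)).ennreal_toReal

/-- Tower property: conditional probabilities form a martingale along the search, whichever box is
inspected next. -/
theorem integral_condProb_update [∀ j, IsProbabilityMeasure (F j)] {E : Set (Fin n → ℝ)}
    (hE : MeasurableSet E) {h : List (Fin n)} {j : Fin n} (hj : j ∉ h) (x : Fin n → ℝ) :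
    ∫ v, condProb F E (j :: h) (Function.update x j v) ∂(F j) = condProb F E h x := by
  have h1 : ∀ v, {y | completeRewards (j :: h) (Function.update x j v) y ∈ E} =
      {y | Function.update y j v ∈ {y | completeRewards h x y ∈ E}} := by
    intro v
    ext y
    simp only [mem_ofPred_eq]
    have : completeRewards (j :: h) (Function.update x j v) y =
        completeRewards h x (Function.update y j v) := by
      ext l
      by_cases hl : l = j
      · subst hl; simp [completeRewards, hj]
      · simp [completeRewards, hl]
    rw [this]
  have hE' : MeasurableSet {y | completeRewards h x y ∈ E} :=
    (measurable_completeRewards h).comp measurable_prodMk_left hE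
  have h2 := pi_update_apply F j (F j) hE'
  rw [Function.update_eq_self] at h2
  rw [condProb, Measure.real, h2, ← integral_toReal]
  · simp_rw [condProb, h1]
    rfl
  · exact (measurable_measure_prodMk_right (measurable_update' hE')).aemeasurable
  · exact ae_of_all _ fun v => measure_lt_top _ _

theorem integrable_condProb_update [∀ j, IsProbabilityMeasure (F j)] {E : Set (Fin n → ℝ)}
    (hE : MeasurableSet E) (h : List (Fin n)) (j : Fin n) (x : Fin n → ℝ) :
    Integrable (fun v => condProb F E h (Function.update x j v)) (F j) := by
  refine Integrable.of_bound (C := 1) ((measurable_condProb hE h).comp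
    (measurable_update x)).aestronglyMeasurable (ae_of_all _ fun v => ?_)
  rw [Real.norm_eq_abs, abs_of_nonneg (condProb_mem E h _).1]
  exact (condProb_mem E h _).2

/-- The histories that arise when closed boxes are inspected in the order of their reservation
prices, and only if their price is at least the maximum sampled reward. -/
structure IsIndexHistory (z : Fin n → ℝ) (h : List (Fin n)) (x : Fin n → ℝ) : Prop where
  opened : ∀ i ∈ h, ∀ l ∈ h, min (x l) (z l) ≤ z i
  closed : ∀ i ∈ h, ∀ l, l ∉ h → z l ≤ z i

/-- For two opened boxes i and l, if l came first then x_l ≤ z_i, as i was inspected only with w ≤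
z_i; if l came later then z_l ≤ z_i. -/
theorem IsIndexHistory.cons {h : List (Fin n)} {x : Fin n → ℝ} (hh : IsIndexHistory z h x)
    {j : Fin n} (hj : j ∉ h) (hw : maxSampled h x ≤ z j) (hmax : ∀ l, l ∉ h → z l ≤ z j) (v : ℝ) :
    IsIndexHistory z (j :: h) (Function.update x j v) where
  opened i hi l hl := by
    rcases List.mem_cons.1 hl with rfl | hlh
    · rcases List.mem_cons.1 hi with rfl | hi
      · exact min_le_right _ _
      · exact (min_le_right _ _).trans (hh.closed i hi l hj)
    · have hlj : l ≠ j := fun e => hj (e ▸ hlh)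
      rw [Function.update_of_ne hlj]
      rcases List.mem_cons.1 hi with rfl | hi
      · exact (min_le_left _ _).trans ((le_maxSampled hlh).trans hw)
      · exact hh.opened i hi l hlh
  closed i hi l hl := by
    rw [List.mem_cons, not_or] at hl
    rcases List.mem_cons.1 hi with rfl | hi
    · exact hmax l hl.2
    · exact hh.closed i hi l hl.2

/-- The truncated reward of a best opened box is min(w, z_i). Opened boxes have x_l ≤ w and
truncated reward at most z_i; closed boxes have z_l ≤ min(w, z_i), whatever their unseen rewards. -/
theorem IsIndexHistory.mem_weakWin {h : List (Fin n)} {x : Fin n → ℝ} (hh : IsIndexHistory z h x)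
    (hw : ∀ l, l ∉ h → z l ≤ maxSampled h x) {i : Fin n} (hi : i ∈ bestOpened h x)
    (y : Fin n → ℝ) : completeRewards h x y ∈ weakWin z i := by
  rw [mem_bestOpened] at hi
  intro l
  have h1 : completeRewards h x y i = maxSampled h x := by
    rw [completeRewards, if_pos hi.1, hi.2]
  rw [h1]
  by_cases hl : l ∈ h
  · rw [completeRewards, if_pos hl]
    exact le_min ((min_le_left _ _).trans (le_maxSampled hl)) (hh.opened i hi.1 l hl)
  · exact (min_le_right _ _).trans (le_min (hw l hl) (hh.closed i hi.1 l hl))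

theorem claimProb_le_condProb [∀ j, IsProbabilityMeasure (F j)] {h : List (Fin n)} {x : Fin n → ℝ}
    (hh : IsIndexHistory z h x) (hw : ∀ l, l ∉ h → z l ≤ maxSampled h x) (i : Fin n) :
    claimProb i h x ≤ condProb F (weakWin z i) h x := by
  by_cases hi : i ∈ bestOpened h x
  · have : {y | completeRewards h x y ∈ weakWin z i} = univ :=
      eq_univ_of_forall (hh.mem_weakWin hw hi)
    rw [condProb, this, probReal_univ]
    exact claimProb_le_one i h x
  · rw [claimProb, if_neg hi]
    exact (condProb_mem _ _ _).1

/-- If i is not the sole member of O*, another member wins weakly and rules out a strict win of i.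
The assumptions on h and x make O* nonempty. -/
theorem condProb_le_claimProb [∀ j, IsProbabilityMeasure (F j)] {h : List (Fin n)} {x : Fin n → ℝ}
    (hne : h ≠ []) (hx : ∀ j, 0 ≤ x j)
    (hh : IsIndexHistory z h x) (hw : ∀ l, l ∉ h → z l ≤ maxSampled h x) (i : Fin n) :
    condProb F (strictWin z i) h x ≤ claimProb i h x := by
  by_cases hi : bestOpened h x = {i}
  · rw [claimProb, hi]
    simpa using (condProb_mem _ _ _).2
  · obtain ⟨l, hl, hlx⟩ := exists_eq_maxSampled hne hx
    have hl' : l ∈ bestOpened h x := mem_bestOpened.2 ⟨hl, hlx⟩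
    obtain ⟨j, hj, hji⟩ : ∃ j ∈ bestOpened h x, j ≠ i := by
      by_contra hcon
      push Not at hcon
      exact hi (Finset.eq_singleton_iff_unique_mem.2 ⟨hcon l hl' ▸ hl', hcon⟩)
    have : {y | completeRewards h x y ∈ strictWin z i} = ∅ := by
      refine eq_empty_of_forall_notMem fun y hy => ?_
      exact absurd (hh.mem_weakWin hw hj y i) (not_le.2 (hy j hji))
    rw [condProb, this, measureReal_empty]
    exact claimProb_nonneg i h x

/-- The selected box has a maximal truncated reward, from any optimal history on. -/
theorem condProb_le_winProbAux_le (hP : IsSearchProblem c β F z) (hn0 : 0 < n) (η : Policy n)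
    (i : Fin n) (k : ℕ) : ∀ (h : List (Fin n)) (x : Fin n → ℝ), h.Nodup → h.length + k = n →
      (∀ j, x j ∈ Icc (0 : ℝ) 1) → IsIndexHistory z h x →
      pandoraValueAux c β F η k h x = searchValue β F z (closedBoxes h) (maxSampled h x) →
      condProb F (strictWin z i) h x ≤ winProbAux F η i k h x ∧
        winProbAux F η i k h x ≤ condProb F (weakWin z i) h x := by
  have := hP.prob
  induction k with
  | zero =>
    intro h x hn hl hx hh _
    have hw : ∀ l, l ∉ h → z l ≤ maxSampled h x :=
      fun l hl' => absurd (mem_of_length_eq hn hl l) hl'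
    have hne : h ≠ [] := by rintro rfl; simp at hl; omega
    exact ⟨condProb_le_claimProb hne (fun j => (hx j).1) hh hw i, claimProb_le_condProb hh hw i⟩
  | succ k ih =>
    intro h x hn hl hx hh heq
    obtain ⟨hs, hv⟩ := tight_of_pandoraValueAux_eq hP η hn hl hx heq
    have hrec : ∀ j, 0 < η.visit h x j → ∀ᵐ v ∂(F j),
        condProb F (strictWin z i) (j :: h) (Function.update x j v) ≤
          winProbAux F η i k (j :: h) (Function.update x j v) ∧
        winProbAux F η i k (j :: h) (Function.update x j v) ≤
          condProb F (weakWin z i) (j :: h) (Function.update x j v) := by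
      intro j hj
      have hjh := η.notMem_of_visit_pos hj
      obtain ⟨h1, h2, h3⟩ := hv j hj
      filter_upwards [h3, ae_mem_Icc_of_compl_null (hP.supp j)] with v hv1 hv2
      exact ih (j :: h) (Function.update x j v) (hn.cons hjh) (by simp; omega)
        (update_mem_Icc hx j hv2) (hh.cons hjh h1 h2 v) hv1
    constructor
    · refine η.le_combination h x (fun hpos => ?_) fun j hj => ?_
      · refine condProb_le_claimProb ?_ (fun j => (hx j).1) hh (hs hpos) i
        -- Stopping before any inspection is never optimal: w = 0 is below every reservation price.
        rintro rfl
        exact absurd (hs hpos ⟨0, hn0⟩ List.not_mem_nil) (not_le.2 (hP.price_pos _))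
      · rw [← integral_condProb_update (measurableSet_strictWin z i) (η.notMem_of_visit_pos hj) x]
        refine integral_mono_ae (integrable_condProb_update (measurableSet_strictWin z i) _ j x)
          (integrable_winProbAux F η i j k _ x) ?_
        filter_upwards [hrec j hj] with v hv using hv.1
    · refine η.combination_le h x (fun hpos => claimProb_le_condProb hh (hs hpos) i) fun j hj => ?_
      rw [← integral_condProb_update (measurableSet_weakWin z i) (η.notMem_of_visit_pos hj) x]
      refine integral_mono_ae (integrable_winProbAux F η i j k _ x)
        (integrable_condProb_update (measurableSet_weakWin z i) _ j x) ?_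
      filter_upwards [hrec j hj] with v hv using hv.2

theorem winProb_mem_of_isOptimal (hP : IsSearchProblem c β F z) (hn0 : 0 < n) {η : Policy n}
    (hη : η.IsOptimal c β F) (i : Fin n) :
    (Measure.pi F).real (strictWin z i) ≤ winProb F η i ∧
      winProb F η i ≤ (Measure.pi F).real (weakWin z i) := by
  have h1 := condProb_le_winProbAux_le hP hn0 η i n [] 0 List.nodup_nil (by simp)
    (fun j => by simp) ⟨by simp, by simp⟩ (pandoraValue_eq_of_isOptimal hP hη)
  have h2 : ∀ E : Set (Fin n → ℝ), condProb F E [] 0 = (Measure.pi F).real E := by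
    intro E
    have : ∀ y : Fin n → ℝ, completeRewards [] 0 y = y := fun y => by ext j; simp [completeRewards]
    simp [condProb, this]
  rwa [h2, h2] at h1

end Winner

/-! ### Payoffs of the boxes -/

section Payoff

variable {n : ℕ} {μ c β : ℝ}

/-- The laws of a profile of pure strategies. -/
noncomputable def profileLaw (F : Fin n → PureStrategy μ) (j : Fin n) : Measure ℝ := (F j).law

instance (F : Fin n → PureStrategy μ) (j : Fin n) : IsProbabilityMeasure (profileLaw F j) :=
  inferInstanceAs (IsProbabilityMeasure (F j).law)

/-- The reservation prices of a profile of pure strategies. -/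
noncomputable def profilePrice (c β : ℝ) (F : Fin n → PureStrategy μ) (j : Fin n) : ℝ :=
  reservationPrice c β (F j).law

theorem profileLaw_update (F : Fin n → PureStrategy μ) (i : Fin n) (H : PureStrategy μ) :
    profileLaw (Function.update F i H) = Function.update (profileLaw F) i H.law := by
  ext1 j
  by_cases h : j = i
  · subst h; simp [profileLaw]
  · simp [profileLaw, h]

theorem isSearchProblem_profile (hc : 0 ≤ c) (hβ0 : 0 < β) (hβ1 : β ≤ 1) (hsearch : c < β * μ)
    (hfric : 0 < c ∨ β < 1) (F : Fin n → PureStrategy μ) :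
    IsSearchProblem c β (profileLaw F) (profilePrice c β F) := by
  have hs : ∀ j, c < β * ∫ x, x ∂(F j).law := fun j => by rw [(F j).integral_law]; exact hsearch
  exact
    { cost_nonneg := hc
      discount_pos := hβ0
      discount_le_one := hβ1
      prob := fun j => inferInstance
      supp := fun j => (F j).law_compl_Icc
      price_eq := fun j => reservationPrice_eq (F j).law_compl_Icc hc hβ0 hβ1 hfric
      price_pos := fun j => reservationPrice_pos (F j).law_compl_Icc hc hβ0 hβ1 hfric (hs j)
      price_lt_one := fun j =>
        reservationPrice_lt_one (F j).law_compl_Icc hc hβ0 hβ1 hfric (hs j)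
      measure_Ioi_pos := fun j =>
        measure_Ioi_reservationPrice_pos (F j).law_compl_Icc hc hβ0 hβ1 hfric (hs j) }

/-- The joint law of the rewards, as a kernel from profiles of pure strategies. -/
noncomputable def rewardKernel (n : ℕ) (μ : ℝ) :
    ProbabilityTheory.Kernel (Fin n → PureStrategy μ) (Fin n → ℝ) where
  toFun F := Measure.pi (profileLaw F)
  measurable' := by
    refine Measurable.measure_of_isPiSystem_of_isProbabilityMeasure generateFrom_pi.symm
      isPiSystem_pi ?_
    rintro _ ⟨s, hs, rfl⟩
    simp_rw [Measure.pi_pi]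
    refine Finset.measurable_fun_prod _ fun j _ => ?_
    exact (Measure.measurable_coe (show MeasurableSet (s j) from hs j (mem_univ j))).comp
      (PureStrategy.measurable_law.comp (measurable_pi_apply j))

instance : ProbabilityTheory.IsMarkovKernel (rewardKernel n μ) :=
  ⟨fun F => inferInstanceAs (IsProbabilityMeasure (Measure.pi (profileLaw F)))⟩

/-- The probability that box `i` has a maximal truncated reward. -/
noncomputable def weakWinProb (c β : ℝ) (i : Fin n) (F : Fin n → PureStrategy μ) : ℝ :=
  (Measure.pi (profileLaw F)).real (weakWin (profilePrice c β F) i)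

theorem weakWinProb_mem (c β : ℝ) (i : Fin n) (F : Fin n → PureStrategy μ) :
    0 ≤ weakWinProb c β i F ∧ weakWinProb c β i F ≤ 1 :=
  ⟨measureReal_nonneg, measureReal_le_one⟩

theorem measurable_weakWinProb (hc : 0 ≤ c) (hβ0 : 0 < β) (hβ1 : β ≤ 1)
    (hfric : 0 < c ∨ β < 1) (i : Fin n) :
    Measurable (weakWinProb (μ := μ) c β i) := by
  have hz : ∀ j, Measurable fun p : (Fin n → PureStrategy μ) × (Fin n → ℝ) =>
      min (p.2 j) (profilePrice c β p.1 j) := fun j =>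
    ((measurable_pi_apply j).comp measurable_snd).min
      ((PureStrategy.measurable_reservationPrice hc hβ0 hβ1 hfric).comp
        ((measurable_pi_apply j).comp measurable_fst))
  have ht : MeasurableSet {p : (Fin n → PureStrategy μ) × (Fin n → ℝ) |
      ∀ j, min (p.2 j) (profilePrice c β p.1 j) ≤ min (p.2 i) (profilePrice c β p.1 i)} := by
    rw [ofPred_forall]
    exact MeasurableSet.iInter fun j => measurableSet_le (hz j) (hz i)
  exact (ProbabilityTheory.Kernel.measurable_kernel_prodMk_left (κ := rewardKernel n μ)
    ht).ennreal_toReal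

/-- Raising the reservation price and, with probability `θ`, the reward of box `i` turns weak wins
into strict wins. -/
theorem weakWinProb_le_strictWin (F : Fin n → PureStrategy μ) (i : Fin n) {G H : PureStrategy μ}
    {θ : ℝ} (hθ : 0 ≤ θ) {T : ℝ → ℝ} (hT : Measurable T)
    (hle : ENNReal.ofReal θ • (H.law.map T) ≤ G.law)
    (hlt : ∀ x ∈ Icc (0 : ℝ) 1, min x (reservationPrice c β H.law) <
        min (T x) (reservationPrice c β G.law)) :
    θ * weakWinProb c β i (Function.update F i H) ≤
      (Measure.pi (profileLaw (Function.update F i G))).real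
        (strictWin (profilePrice c β (Function.update F i G)) i) := by
  have hE := measurableSet_strictWin (profilePrice c β (Function.update F i G)) i
  have hmeas : Measurable fun v => Measure.pi (profileLaw F)
      {y | Function.update y i v ∈ strictWin (profilePrice c β (Function.update F i G)) i} :=
    measurable_measure_prodMk_right (measurable_update' hE)
  have key : ENNReal.ofReal θ * Measure.pi (profileLaw (Function.update F i H))
      (weakWin (profilePrice c β (Function.update F i H)) i) ≤
      Measure.pi (profileLaw (Function.update F i G))
        (strictWin (profilePrice c β (Function.update F i G)) i) := by
    rw [profileLaw_update, profileLaw_update, pi_update_apply _ _ _ hE,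
      pi_update_apply _ _ _ (measurableSet_weakWin _ i)]
    -- Of the law of G only the part θ · T_*H is kept. On it the reward x of H becomes T x while the
    -- other rewards stay fixed.
    refine le_trans ?_ (lintegral_mono' hle le_rfl)
    rw [lintegral_smul_measure, smul_eq_mul, lintegral_map hmeas hT]
    refine mul_le_mul_right (lintegral_mono_ae ?_) _
    filter_upwards [ae_mem_Icc_of_compl_null H.law_compl_Icc] with x hx
    refine measure_mono fun y hy j hj => ?_
    have h1 : min (Function.update y i x j) (profilePrice c β (Function.update F i H) j) ≤
      min (Function.update y i x i) (profilePrice c β (Function.update F i H) i) := hy j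
    simp only [profilePrice, Function.update_self, Function.update_of_ne hj] at h1 ⊢
    exact h1.trans_lt (hlt x hx)
  have h2 := ENNReal.toReal_mono (measure_ne_top _ _) key
  rwa [ENNReal.toReal_mul, ENNReal.toReal_ofReal hθ] at h2

/-- If all reservation prices coincide, ties make the probabilities of having a maximal truncated
reward add up to more than one. -/
theorem one_lt_sum_weakWinProb (hn : 2 ≤ n) {F : Fin n → PureStrategy μ}
    (hP : IsSearchProblem c β (profileLaw F) (profilePrice c β F)) {z : ℝ}
    (hz : ∀ j, profilePrice c β F j = z) : 1 < ∑ i, weakWinProb c β i F := by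
  set R : Set (Fin n → ℝ) := univ.pi fun _ => Ioi z with hR
  have hRm : MeasurableSet R := MeasurableSet.univ_pi fun _ => measurableSet_Ioi
  have hRpos : 0 < (Measure.pi (profileLaw F)).real R := by
    refine ENNReal.toReal_pos ?_ (measure_ne_top _ _)
    rw [hR, Measure.pi_pi]
    refine Finset.prod_ne_zero_iff.2 fun j _ => ?_
    have := hP.measure_Ioi_pos j
    rw [hz] at this
    exact this.ne'
  -- Counting weak winners pointwise: there is always one, and all n ≥ 2 boxes tie at z when every
  -- reward exceeds z.
  have hpt : ∀ y : Fin n → ℝ, 1 + R.indicator 1 y ≤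
      ∑ i, (weakWin (profilePrice c β F) i).indicator (1 : (Fin n → ℝ) → ℝ) y := by
    intro y
    by_cases hy : y ∈ R
    · have h1 : ∀ i ∈ Finset.univ,
          (weakWin (profilePrice c β F) i).indicator (1 : (Fin n → ℝ) → ℝ) y = 1 := by
        intro i _
        refine indicator_of_mem (fun j => ?_) _
        rw [hz, hz, min_eq_right (mem_Ioi.1 (hy j (mem_univ j))).le,
          min_eq_right (mem_Ioi.1 (hy i (mem_univ i))).le]
      rw [Finset.sum_congr rfl h1, indicator_of_mem hy]
      simp only [Pi.one_apply, Finset.sum_const, Finset.card_univ, Fintype.card_fin, nsmul_eq_mul,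
        mul_one]
      have : (2 : ℝ) ≤ n := by exact_mod_cast hn
      linarith
    · have hne : Nonempty (Fin n) := ⟨⟨0, by omega⟩⟩
      obtain ⟨i, hi⟩ := Finite.exists_max fun j => min (y j) (profilePrice c β F j)
      rw [indicator_of_notMem hy, add_zero]
      have h1 := Finset.single_le_sum (f := fun i =>
        (weakWin (profilePrice c β F) i).indicator (1 : (Fin n → ℝ) → ℝ) y)
        (fun j _ => indicator_nonneg (fun _ _ => zero_le_one) _) (Finset.mem_univ i)
      rwa [indicator_of_mem (show y ∈ weakWin (profilePrice c β F) i from hi)] at h1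
  have hind : ∀ E : Set (Fin n → ℝ), MeasurableSet E →
      Integrable (E.indicator (1 : (Fin n → ℝ) → ℝ)) (Measure.pi (profileLaw F)) := fun E hE =>
    (integrable_const (1 : ℝ)).indicator hE
  have hint := integral_mono ((integrable_const (1 : ℝ)).add (hind R hRm))
    (integrable_finsetSum Finset.univ fun i _ => hind _ (measurableSet_weakWin _ i)) hpt
  rw [integral_finsetSum _ fun i _ => hind _ (measurableSet_weakWin _ i)] at hint
  simp only [Pi.add_apply] at hint
  rw [integral_add (integrable_const _) (hind R hRm), integral_indicator_one hRm] at hint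
  simp only [integral_indicator_one (measurableSet_weakWin _ _), integral_const, probReal_univ,
    smul_eq_mul, mul_one] at hint
  have : ∑ i, weakWinProb c β i F = ∑ i, (Measure.pi (profileLaw F)).real
    (weakWin (profilePrice c β F) i) := rfl
  linarith

/-- The probability that box `i` is selected at a profile of pure strategies. -/
noncomputable def profileWinProb (η : PandoraStrategy n μ) (i : Fin n)
    (F : Fin n → PureStrategy μ) : ℝ := winProb (profileLaw F) (η.policy F) i

variable (η : PandoraStrategy n μ) (i : Fin n)

theorem profileWinProb_mem (F : Fin n → PureStrategy μ) :
    0 ≤ profileWinProb η i F ∧ profileWinProb η i F ≤ 1 :=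
  winProbAux_mem (profileLaw F) (η.policy F) i n [] 0

theorem measurable_profileWinProb : Measurable (profileWinProb η i) :=
  (measurable_winProbAux (fun j => (PureStrategy.lawKernel μ).comap
    (fun F : Fin n → PureStrategy μ => F j) (measurable_pi_apply j)) η.policy
    η.measurable_policy i n []).comp (measurable_id.prodMk measurable_const)

theorem integrable_of_mem_Icc {α : Type*} [MeasurableSpace α] {ν : Measure α} [IsFiniteMeasure ν]
    {f : α → ℝ} (hf : Measurable f) (hb : ∀ a, 0 ≤ f a ∧ f a ≤ 1) : Integrable f ν :=
  Integrable.of_bound (C := 1) hf.aestronglyMeasurable (ae_of_all _ fun a => by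
    rw [Real.norm_eq_abs, abs_of_nonneg (hb a).1]; exact (hb a).2)

/-- Conditioning on the draw of box i: the profile is averaged over the opponents first, with
coordinate i overwritten by H. -/
theorem integral_pi_eq_integral_update {X : Type*} [MeasurableSpace X] (s : Measure X)
    [IsProbabilityMeasure s] {f : (Fin n → X) → ℝ} (hf : Measurable f)
    (hb : ∀ a, 0 ≤ f a ∧ f a ≤ 1) :
    ∫ F, f F ∂(Measure.pi fun _ : Fin n => s) =
      ∫ H, ∫ F, f (Function.update F i H) ∂(Measure.pi fun _ : Fin n => s) ∂s := by
  have h1 := measurePreserving_update_pi_prod (fun _ : Fin n => s) i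
  rw [← integral_prod_symm (f := fun p : (Fin n → X) × X => f (Function.update p.1 i p.2))
    (integrable_of_mem_Icc (hf.comp measurable_update') fun _ => hb _)]
  conv_lhs => rw [← h1.map_eq]
  exact integral_map h1.measurable.aemeasurable hf.aestronglyMeasurable

/-- The mixed strategy that plays one pure strategy. -/
noncomputable def pureMixed (H : PureStrategy μ) : MixedStrategy μ :=
  ⟨Measure.dirac H, inferInstance⟩

theorem boxPayoff_pureMixed (s : MixedStrategy μ) (H : PureStrategy μ) :
    boxPayoff η (Function.update (fun _ => s) i (pureMixed H)) i =
      ∫ F, profileWinProb η i (Function.update F i H)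
        ∂(Measure.pi fun _ : Fin n => (s : Measure (PureStrategy μ))) := by
  have h1 : (fun j => ((Function.update (fun _ : Fin n => s) i
      (pureMixed H) j : MixedStrategy μ) :
      Measure (PureStrategy μ))) =
      Function.update (fun _ : Fin n => (s : Measure (PureStrategy μ))) i (Measure.dirac H) := by
    ext1 j
    by_cases h : j = i
    · subst h; rw [Function.update_self, Function.update_self]; rfl
    · simp only [Function.update_of_ne h]
  have h2 : boxPayoff η (Function.update (fun _ => s) i (pureMixed H)) i =
      ∫ F, profileWinProb η i F ∂(Measure.pi (Function.update
        (fun _ : Fin n => (s : Measure (PureStrategy μ))) i (Measure.dirac H))) := by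
    rw [← h1]; rfl
  have hm : Measurable fun p : (Fin n → PureStrategy μ) × PureStrategy μ =>
      profileWinProb η i (Function.update p.1 i p.2) :=
    (measurable_profileWinProb η i).comp measurable_update'
  rw [h2, ← map_update_pi_prod, integral_map measurable_update'.aemeasurable
    (measurable_profileWinProb η i).aestronglyMeasurable, Measure.prod_dirac,
    integral_map measurable_prodMk_right.aemeasurable hm.aestronglyMeasurable]

end Payoff

/-! ### Indifference and ties at a symmetric equilibrium. -/

section Equilibrium

variable {n : ℕ} {μ c β : ℝ} {η : PandoraStrategy n μ} {s : MixedStrategy μ}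

/-- Perturbations of H earn at least θ times the payoff that H would have if it won all its ties,
for θ arbitrarily close to 1, and no deviation beats the equilibrium payoff. -/
theorem integral_weakWinProb_le_boxPayoff (hn : 2 ≤ n) (hμ0 : 0 < μ) (hμ1 : μ ≤ 1)
    (hc : 0 ≤ c) (hβ0 : 0 < β) (hβ1 : β ≤ 1) (hsearch : c < β * μ) (hfric : 0 < c ∨ β < 1)
    (hη : IsFSPE c β η fun _ => s) (i : Fin n) {H : PureStrategy μ}
    (hH : reservationPrice c β H.law < reservationPrice c β (priorLaw μ)) :
    ∫ F, weakWinProb c β i (Function.update F i H)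
      ∂(Measure.pi fun _ : Fin n => (s : Measure (PureStrategy μ))) ≤
      boxPayoff η (fun _ => s) i := by
  set A := ∫ F, weakWinProb c β i (Function.update F i H)
      ∂(Measure.pi fun _ : Fin n => (s : Measure (PureStrategy μ))) with hA
  set U := boxPayoff η (fun _ => s) i with hU
  have hU0 : 0 ≤ U := integral_nonneg fun F => (profileWinProb_mem η i F).1
  obtain ⟨θ₀, hθ₀, hpert⟩ := exists_perturbation hμ0 hμ1 hc hβ0 hβ1 hsearch hfric H hH
  by_contra hlt
  rw [not_le] at hlt
  have hA0 : 0 < A := hU0.trans_lt hlt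
  -- With θ > U / A the deviation earns at least θA > U.
  obtain ⟨θ, hθ, hθ1⟩ : ∃ θ, max θ₀ (U / A) < θ ∧ θ < 1 :=
    exists_between (max_lt hθ₀ ((div_lt_one hA0).2 hlt))
  rw [max_lt_iff, div_lt_iff₀ hA0] at hθ
  have hθ0 : 0 ≤ θ := by
    by_contra h
    nlinarith [hθ.2]
  obtain ⟨G, T, hT, hle, -, hwin⟩ := hpert θ hθ.1 hθ1
  have h1 := hη.no_deviation i (pureMixed G)
  rw [boxPayoff_pureMixed] at h1
  have hupd : ∀ K : PureStrategy μ, Measurable fun F : Fin n → PureStrategy μ =>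
    Function.update F i K := fun K => measurable_update'.comp measurable_prodMk_right
  have h2 : ∫ F, θ * weakWinProb c β i (Function.update F i H)
      ∂(Measure.pi fun _ : Fin n => (s : Measure (PureStrategy μ))) ≤
      ∫ F, profileWinProb η i (Function.update F i G)
      ∂(Measure.pi fun _ : Fin n => (s : Measure (PureStrategy μ))) := by
    refine integral_mono ((integrable_of_mem_Icc ((measurable_weakWinProb hc hβ0 hβ1 hfric i).comp
      (hupd H)) fun _ => weakWinProb_mem c β i _).const_mul θ)
      (integrable_of_mem_Icc ((measurable_profileWinProb η i).comp (hupd G))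
        fun _ => profileWinProb_mem η i _) fun F => ?_
    exact (weakWinProb_le_strictWin F i hθ0 hT hle hwin).trans
      (winProb_mem_of_isOptimal (isSearchProblem_profile hc hβ0 hβ1 hsearch hfric _) (by omega)
        (hη.optimal _) i).1
  rw [integral_const_mul] at h2
  linarith [hθ.2]

/-- At an equilibrium, a box with a reservation price below that of the prior is selected with the
probability that its truncated reward is maximal. -/
theorem ae_weakWinProb_eq (hn : 2 ≤ n) (hμ0 : 0 < μ) (hμ1 : μ ≤ 1)
    (hc : 0 ≤ c) (hβ0 : 0 < β) (hβ1 : β ≤ 1) (hsearch : c < β * μ) (hfric : 0 < c ∨ β < 1)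
    (hη : IsFSPE c β η fun _ => s) (i : Fin n) :
    ∀ᵐ F ∂(Measure.pi fun _ : Fin n => (s : Measure (PureStrategy μ))),
      profilePrice c β F i < reservationPrice c β (priorLaw μ) →
        weakWinProb c β i F = profileWinProb η i F := by
  set π := Measure.pi fun _ : Fin n => (s : Measure (PureStrategy μ)) with hπ
  set U := boxPayoff η (fun _ => s) i with hU
  set u : PureStrategy μ → ℝ := fun H => ∫ F, profileWinProb η i (Function.update F i H) ∂π with hu
  have hW := measurable_profileWinProb η i
  have hA := measurable_weakWinProb (μ := μ) hc hβ0 hβ1 hfric i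
  have hupd : ∀ K : PureStrategy μ, Measurable fun F : Fin n → PureStrategy μ =>
    Function.update F i K := fun K => measurable_update'.comp measurable_prodMk_right
  have hWA : ∀ F : Fin n → PureStrategy μ, profileWinProb η i F ≤ weakWinProb c β i F := fun F =>
    (winProb_mem_of_isOptimal (isSearchProblem_profile hc hβ0 hβ1 hsearch hfric F) (by omega)
      (hη.optimal F) i).2
  have hUu : U = ∫ H, u H ∂(s : Measure (PureStrategy μ)) :=
    integral_pi_eq_integral_update i _ hW (profileWinProb_mem η i)
  have hle : ∀ H, u H ≤ U := fun H => by
    have := hη.no_deviation i (pureMixed H)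
    rwa [boxPayoff_pureMixed] at this
  have hum : Measurable u :=
    ((hW.comp measurable_update').stronglyMeasurable.integral_prod_left').measurable
  have hub : ∀ H, 0 ≤ u H ∧ u H ≤ 1 := fun H =>
    ⟨integral_nonneg fun F => (profileWinProb_mem η i _).1, by
      have := integral_mono (μ := π) (integrable_of_mem_Icc (hW.comp (hupd H))
        fun _ => profileWinProb_mem η i _) (integrable_const (1 : ℝ))
        fun F => (profileWinProb_mem η i _).2
      simpa using this⟩
  -- Indifference: U is the average of u under s, and no pure deviation earns more than U.
  have hae : u =ᵐ[(s : Measure (PureStrategy μ))] fun _ => U :=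
    (integral_eq_iff_of_ae_le (integrable_of_mem_Icc hum hub) (integrable_const _)
      (ae_of_all _ hle)).1 (by rw [← hUu, integral_const, probReal_univ, one_smul])
  set B : Set (Fin n → PureStrategy μ) :=
    {F | profilePrice c β F i < reservationPrice c β (priorLaw μ)} with hB
  have hBm : MeasurableSet B := measurableSet_lt
    ((PureStrategy.measurable_reservationPrice hc hβ0 hβ1 hfric).comp (measurable_pi_apply i))
    measurable_const
  -- The ties that box i fails to win, at profiles where its price is below that of the prior. This
  -- is nonnegative, so a zero integral makes it vanish almost surely.
  set g : (Fin n → PureStrategy μ) → ℝ :=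
    B.indicator fun F => weakWinProb c β i F - profileWinProb η i F with hg
  have hgm : Measurable g := (hA.sub hW).indicator hBm
  have hgb : ∀ F, 0 ≤ g F ∧ g F ≤ 1 := by
    intro F
    have h1 := hWA F
    have h2 := weakWinProb_mem c β i F
    have h3 := profileWinProb_mem η i F
    rw [hg]
    by_cases hF : F ∈ B
    · rw [indicator_of_mem hF]
      constructor <;> linarith
    · rw [indicator_of_notMem hF]
      simp
  have hg0 : ∫ F, g F ∂π = 0 := by
    rw [hπ, integral_pi_eq_integral_update i _ hgm hgb, ← hπ]
    refine integral_eq_zero_of_ae ?_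
    filter_upwards [hae] with H hH
    show ∫ F, g (Function.update F i H) ∂π = 0
    by_cases hHB : reservationPrice c β H.law < reservationPrice c β (priorLaw μ)
    · have h1 : ∀ F, g (Function.update F i H) =
          weakWinProb c β i (Function.update F i H) -
            profileWinProb η i (Function.update F i H) := fun F =>
        indicator_of_mem (show Function.update F i H ∈ B by
          simpa [hB, profilePrice] using hHB) _
      have h2 : ∫ F, g (Function.update F i H) ∂π =
          (∫ F, weakWinProb c β i (Function.update F i H) ∂π) - u H := by
        simp_rw [h1]
        exact integral_sub (integrable_of_mem_Icc (hA.comp (hupd H))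
          fun _ => weakWinProb_mem c β i _) (integrable_of_mem_Icc (hW.comp (hupd H))
          fun _ => profileWinProb_mem η i _)
      -- The average of g given H is the weak win probability of H, at most U, minus u H = U.
      have h3 := integral_weakWinProb_le_boxPayoff hn hμ0 hμ1 hc hβ0 hβ1 hsearch hfric hη i hHB
      have h4 : 0 ≤ ∫ F, g (Function.update F i H) ∂π := integral_nonneg fun F => (hgb _).1
      have h5 : u H = U := hH
      refine le_antisymm ?_ h4
      rw [h2, h5]
      exact sub_nonpos.2 h3
    · have h1 : ∀ F, g (Function.update F i H) = 0 := fun F =>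
        indicator_of_notMem (show Function.update F i H ∉ B by
          simpa [hB, profilePrice] using hHB) _
      simp [h1]
  have hgae := (integral_eq_zero_iff_of_nonneg (fun F => (hgb F).1)
    (integrable_of_mem_Icc hgm hgb)).1 hg0
  filter_upwards [hgae] with F hF hFB
  have h1 : g F = weakWinProb c β i F - profileWinProb η i F :=
    indicator_of_mem (show F ∈ B from hFB) _
  have h2 : g F = 0 := hF
  linarith

end Equilibrium

theorem proposition8 (n : ℕ) (hn : 2 ≤ n) (μ c β : ℝ) (hμ0 : 0 < μ) (hμ1 : μ ≤ 1)
    (hc : 0 ≤ c) (hβ0 : 0 < β) (hβ1 : β ≤ 1) (hsearch : c < β * μ) (hfric : 0 < c ∨ β < 1) :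
    ¬ ∃ (η : PandoraStrategy n μ) (s : MixedStrategy μ),
      IsFSPE c β η (fun _ : Fin n => s) ∧
      ∃ (z : ℝ) (a : ENNReal), z ≠ reservationPrice c β (priorLaw μ) ∧ 0 < a ∧
        HasInducedMass c β s z a := by
  rintro ⟨η, s, hη, z, a, hz, ha, hmass⟩
  set B : Set (PureStrategy μ) := {F | reservationPrice c β F.law = z} with hB
  have hmass' : (s : Measure (PureStrategy μ)) B = a := hmass
  -- By independence all boxes draw the price z with probability a^n > 0, so some such profile also
  -- satisfies the almost sure identities for every box.
  have hpos : Measure.pi (fun _ : Fin n => (s : Measure (PureStrategy μ)))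
      (univ.pi fun _ => B) ≠ 0 := by
    rw [Measure.pi_pi, hmass']
    exact Finset.prod_ne_zero_iff.2 fun _ _ => ha.ne'
  have hae := ae_all_iff.2 fun i =>
    ae_weakWinProb_eq hn hμ0 hμ1 hc hβ0 hβ1 hsearch hfric hη i
  obtain ⟨F, hFB, hF⟩ := ((frequently_ae_mem_iff.2 hpos).and_eventually hae).exists
  have hFz : ∀ j, profilePrice c β F j = z := fun j => hFB j (mem_univ j)
  have hzlt : z < reservationPrice c β (priorLaw μ) := by
    refine lt_of_le_of_ne ?_ hz
    rw [← hFz ⟨0, by omega⟩]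
    exact reservationPrice_le_priorLaw hμ0 hμ1 hc hβ0 hβ1 hsearch hfric _
  have h1 := one_lt_sum_weakWinProb hn
    (isSearchProblem_profile hc hβ0 hβ1 hsearch hfric F) hFz
  have h2 : ∑ i, weakWinProb c β i F = ∑ i, profileWinProb η i F :=
    Finset.sum_congr rfl fun i _ => hF i (by rw [hFz i]; exact hzlt)
  have h3 : ∑ i, profileWinProb η i F ≤ 1 := sum_winProbAux_le_one _ (η.policy F) n [] 0
  linarith
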